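/- Let $(X,\mu)$ be a standard Borel probability space and let $T$ be an ergodic automorphism of $(X,\mu)$ (an invertible measure-preserving transformation). The local rank $\beta(T)$ is the largest $\beta$ for which there are finite measurable partitions $\xi_j=\{B_j,TB_j,\dots,T^{h_j-1}B_j,C_j^1,\dots,C_j^{m_j}\}$ of $X$ such that $\mu\big(\bigsqcup_{0\le k<h_j}T^kB_j\big)\to\beta$ and every measurable set $A$ is approximated by $\xi_j$-measurable sets $A_j$, that is, $\mu(A\mathbin{\triangle}A_j)\to0$. A self-joining of $T$ is a $T\times T$-invariant measure on $X\times X$ both of whose marginals are $\mu$; $\Delta$ is the diagonal self-joining, $\Delta(A\times B)=\mu(A\cap B)$; and $\nu_i\to\nu$ means that $\nu_i(A\times B)\to\nu(A\times B)$ for all measurable $A,B$. For a self-joining $\nu$ with conditional measures $\nu_x$, $\nu(A\times B)=\int_A\nu_x(B)\,d\mu(x)$, the relatively independent square $\nu\otimes_X\nu$ is the measure on $X\times X$ with $(\nu\otimes_X\nu)(A\times B)=\int_X\nu_x(A)\,\nu_x(B)\,d\mu(x)$. **Theorem.** Suppose that $\beta(T)>0$ and that $T$ has a sequence of self-joinings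 $\nu_i\to\Delta$ such that for every $i$ the measures $\nu_i\otimes_X\nu_i$ and $\Delta$ are mutually singular. Then $T$ is partially rigid: there is $\rho\in(0,1]$ such that $$\limsup_{n\to\infty}\mu(A\cap T^nA)\ \ge\ \rho\,\mu(A)\qquad\text{for every measurable } A.$$ In fact, for every $\varepsilon\in(0,1)$ there are positive integers $z_i\to\infty$ and a positive bounded linear operator $Q$ on $L_2(X,\mu)$ (one that maps nonnegative functions to nonnegative functions) such that $$T^{z_i}\ \longrightarrow\ \beta(T)(1-\varepsilon)\,I+Q$$ in the weak operator topology, where $T$ also denotes the operator $f\mapsto f\circ T$ on $L_2(X,\mu)$. -/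

import Mathlib

open MeasureTheory ProbabilityTheory Filter Topology
open scoped symmDiff

noncomputable section

namespace LocalRank

variable {X : Type*} [MeasurableSpace X]

/-- A finite measurable partition of `X` of the form
`{B, T B, …, T ^ (h - 1) B, C 1, …, C m}`: a Rokhlin tower of height `h` with base `B`,
together with finitely many further cells. -/
structure TowerPartition (T : X ≃ᵐ X) where
  /-- the base of the tower -/
  base : Set X
  /-- the number of levels of the tower -/
  height : ℕ
  /-- the number of cells outside the tower -/
  rest : ℕ
  /-- the cells outside the tower -/
  outer : Fin rest → Set X
  measurableSet_base : MeasurableSet base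
  measurableSet_outer : ∀ l, MeasurableSet (outer l)
  pairwise_disjoint : Pairwise (Function.onFun Disjoint
    (Sum.elim (fun k : Fin height => (T^[(k : ℕ)]) '' base) outer))
  iUnion_eq : (⋃ c, Sum.elim (fun k : Fin height => (T^[(k : ℕ)]) '' base) outer c) = Set.univ

/-- The cells of the partition: the levels `T ^ k B` for `k < h`, and the outer cells. -/
def TowerPartition.cell {T : X ≃ᵐ X} (ξ : TowerPartition T) :
    Fin ξ.height ⊕ Fin ξ.rest → Set X :=
  Sum.elim (fun k : Fin ξ.height => (T^[(k : ℕ)]) '' ξ.base) ξ.outer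

/-- The union `U` of the levels of the tower. -/
def TowerPartition.tower {T : X ≃ᵐ X} (ξ : TowerPartition T) : Set X :=
  ⋃ k : Fin ξ.height, (T^[(k : ℕ)]) '' ξ.base

/-- A set is `ξ`-measurable if it is a union of cells of `ξ`. -/
def TowerPartition.IsMeas {T : X ≃ᵐ X} (ξ : TowerPartition T) (A : Set X) : Prop :=
  ∃ S : Set (Fin ξ.height ⊕ Fin ξ.rest), A = ⋃ c ∈ S, ξ.cell c

/-- `ξ j → ε`: every measurable set is approximated, as `j → ∞`, by `ξ j`-measurable sets. -/
def TendsToPoints (μ : Measure X) {T : X ≃ᵐ X} (ξ : ℕ → TowerPartition T) : Prop :=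
  ∀ A : Set X, MeasurableSet A → ∃ A' : ℕ → Set X,
    (∀ j, (ξ j).IsMeas (A' j)) ∧ Tendsto (fun j => μ (A ∆ A' j)) atTop (𝓝 0)

/-- There is an approximating sequence of `b`-towers: tower partitions `ξ j → ε` whose towers
have measures tending to `b`. -/
def HasTowers (μ : Measure X) (T : X ≃ᵐ X) (b : ℝ) : Prop :=
  ∃ ξ : ℕ → TowerPartition T,
    TendsToPoints μ ξ ∧ Tendsto (fun j => μ.real (ξ j).tower) atTop (𝓝 b)

/-- The local rank `β(T)`: the largest `b` for which there is an approximating sequence of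
`b`-towers. -/
def localRank (μ : Measure X) (T : X ≃ᵐ X) : ℝ :=
  sSup {b : ℝ | HasTowers μ T b}

/-- A self-joining (of order 2) of `T`: a `T × T`-invariant measure on `X × X` both of whose
marginals are `μ`. -/
structure IsSelfJoining (μ : Measure X) (T : X ≃ᵐ X) (ν : Measure (X × X)) : Prop where
  map_eq : ν.map (Prod.map T T) = ν
  fst_eq : ν.fst = μ
  snd_eq : ν.snd = μ

/-- The diagonal joining: `Δ (A × B) = μ (A ∩ B)`. -/
def diag (μ : Measure X) : Measure (X × X) :=
  μ.map (fun x => (x, x))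

/-- Convergence of joinings: convergence on all measurable rectangles. -/
def JoiningsTendsto (ν : ℕ → Measure (X × X)) (ν' : Measure (X × X)) : Prop :=
  ∀ A B : Set X, MeasurableSet A → MeasurableSet B →
    Tendsto (fun i => ν i (A ×ˢ B)) atTop (𝓝 (ν' (A ×ˢ B)))

/-- The relatively independent product `ν ⊗_X ν'` over the first coordinate:
`(ν ⊗_X ν') (A × B) = ∫ ν_x(A) ν'_x(B) dμ(x)`, where `ν(A × B) = ∫_A ν_x(B) dμ(x)`. -/
def relProd [StandardBorelSpace X] [Nonempty X] (μ : Measure X)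
    (ν ν' : Measure (X × X)) [IsFiniteMeasure ν] [IsFiniteMeasure ν'] : Measure (X × X) :=
  μ.bind (fun x => (ν.condKernel x).prod (ν'.condKernel x))

/-- `T` is partially rigid: for some `ρ ∈ (0, 1]`, every measurable set `A` satisfies
`limsup μ (A ∩ T ^ i A) ≥ ρ μ (A)` as `i → ∞`. -/
def PartiallyRigid (μ : Measure X) (T : X ≃ᵐ X) : Prop :=
  ∃ ρ : ℝ, 0 < ρ ∧ ρ ≤ 1 ∧ ∀ A : Set X, MeasurableSet A →
    ENNReal.ofReal ρ * μ A ≤ limsup (fun i : ℕ => μ (A ∩ (T^[i]) '' A)) atTop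

/-- The unitary operator `f ↦ f ∘ T` induced by `T` on real `L²(μ)`. -/
def koopman {μ : Measure X} {T : X ≃ᵐ X} (hT : MeasurePreserving T μ μ) :
    Lp ℝ 2 μ →L[ℝ] Lp ℝ 2 μ :=
  (Lp.compMeasurePreservingₗᵢ ℝ T hT).toContinuousLinearMap

/-- Convergence in the weak operator topology of a sequence of operators on `L²(μ)`. -/
def WeakOpTendsto {μ : Measure X} (P : ℕ → Lp ℝ 2 μ →L[ℝ] Lp ℝ 2 μ)
    (P' : Lp ℝ 2 μ →L[ℝ] Lp ℝ 2 μ) : Prop :=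
  ∀ f g : Lp ℝ 2 μ, Tendsto (fun i => inner ℝ (P i f) g) atTop (𝓝 (inner ℝ (P' f) g))

/-- An operator on `L²(μ)` is positive if it maps nonnegative functions to nonnegative ones. -/
def IsPositiveOp {μ : Measure X} (Q : Lp ℝ 2 μ →L[ℝ] Lp ℝ 2 μ) : Prop :=
  ∀ f : Lp ℝ 2 μ, 0 ≤ f → 0 ≤ Q f

end LocalRank

end

noncomputable section

namespace LocalRank

variable {X : Type*} [MeasurableSpace X]

/-! ### The relatively independent square of a self-joining. -/

section RelProd

variable [StandardBorelSpace X] [Nonempty X] {μ : Measure X} {T : X ≃ᵐ X}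
  {ν : Measure (X × X)} [IsFiniteMeasure ν]

/-! Write `m_i` for the square of `ν_i` relative to the first coordinate. It is symmetric, `T ×
T`-invariant, has marginals `μ`, and `m_i → Δ` in the sense that `m_i(A × Aᶜ) → 0`. Singularity to
`Δ` forces almost every conditional measure of `ν_i` to be atomless, so `m_i` vanishes on every
graph, in particular on those of the powers `T^k` (`relProd_graph_eq_zero`).

Take a tower of height `h` and measure close to `b`. Invariance makes `m_i` constant along each
off-diagonal of products of levels `(a, a + k)`. Cauchy–Schwarz on about `1/ε` blocks of about `εh`
levels shows that the off-diagonals with `k ≤ εh` carry mass bounded below independently of the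
tower and of `i` (`sq_measureReal_tower_le`). As cells shrink to points, each fixed off-diagonal
shrinks to a graph and loses its mass, so the bounded-below mass sits on `K ≤ k ≤ εh`. Since `m_i(A
× Aᶜ)` is small, a pigeonhole over `k` finds one such `k` for which `T^k` moves few levels out of
each of finitely many given sets (`exists_card_escaping_mul_le`).

On the union `E` of the lowest `h - k` levels, `T^k` thus almost preserves these sets. As `E` is
almost `T`-invariant, ergodicity makes it almost independent of them, and `μ(E)` is nearly at least
`(1 - ε) b`. So the part of `T^k` seen on `E` acts like `(1 - ε) b` times the identity
(`exists_return_time`). A diagonal choice over a countable dense family of sets and weak compactness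
give the limit operator; what remains after removing the multiple of the identity is positive. -/

theorem relProd_apply {S : Set (X × X)} (hS : MeasurableSet S) :
    relProd μ ν ν S = ∫⁻ x, (ν.condKernel x).prod (ν.condKernel x) S ∂μ := by
  refine Measure.bind_apply hS ?_
  have h : (fun x => (ν.condKernel x).prod (ν.condKernel x)) =
      ⇑(ν.condKernel ×ₖ ν.condKernel) := by
    ext1 x
    rw [Kernel.prod_apply]
  rw [h]
  exact (Kernel.measurable _).aemeasurable

theorem relProd_prod {A B : Set X} (hA : MeasurableSet A) (hB : MeasurableSet B) :
    relProd μ ν ν (A ×ˢ B) = ∫⁻ x, ν.condKernel x A * ν.condKernel x B ∂μ := by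
  rw [relProd_apply (hA.prod hB)]
  simp only [Measure.prod_prod]

theorem relProd_prod_swap {A B : Set X} (hA : MeasurableSet A) (hB : MeasurableSet B) :
    relProd μ ν ν (A ×ˢ B) = relProd μ ν ν (B ×ˢ A) := by
  simp only [relProd_prod hA hB, relProd_prod hB hA, mul_comm]

theorem setLIntegral_condKernel (hfst : ν.fst = μ) {A B : Set X} (hA : MeasurableSet A)
    (hB : MeasurableSet B) : ∫⁻ x in A, ν.condKernel x B ∂μ = ν (A ×ˢ B) := by
  rw [← hfst]
  exact Measure.setLIntegral_condKernel_eq_measure_prod hA hB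

theorem lintegral_condKernel (hν : IsSelfJoining μ T ν) {B : Set X} (hB : MeasurableSet B) :
    ∫⁻ x, ν.condKernel x B ∂μ = μ B := by
  rw [← setLIntegral_univ, setLIntegral_condKernel hν.fst_eq .univ hB]
  conv_rhs => rw [← hν.snd_eq, Measure.snd_apply hB]
  congr 1
  ext; simp

theorem relProd_prod_univ (hν : IsSelfJoining μ T ν) {A : Set X} (hA : MeasurableSet A) :
    relProd μ ν ν (A ×ˢ Set.univ) = μ A := by
  rw [relProd_prod hA .univ]
  simp [lintegral_condKernel hν hA]

theorem relProd_univ_prod (hν : IsSelfJoining μ T ν) {A : Set X} (hA : MeasurableSet A) :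
    relProd μ ν ν (Set.univ ×ˢ A) = μ A := by
  rw [relProd_prod_swap .univ hA, relProd_prod_univ hν hA]

theorem isProbabilityMeasure_relProd [IsProbabilityMeasure μ] (hν : IsSelfJoining μ T ν) :
    IsProbabilityMeasure (relProd μ ν ν) :=
  ⟨by rw [← Set.univ_prod_univ, relProd_prod_univ hν .univ, measure_univ]⟩

/-- Invariance of `ν` read fibrewise: both sides have the same integral over every measurable set.
-/
theorem condKernel_image_ae [IsProbabilityMeasure μ] (hT : MeasurePreserving T μ μ)
    (hν : IsSelfJoining μ T ν) {A : Set X} (hA : MeasurableSet A) :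
    ∀ᵐ x ∂μ, ν.condKernel (T x) (T '' A) = ν.condKernel x A := by
  have hTA : MeasurableSet (T '' A) := T.measurableSet_image.2 hA
  refine ae_eq_of_forall_setLIntegral_eq_of_sigmaFinite
    ((Kernel.measurable_coe _ hTA).comp T.measurable) (Kernel.measurable_coe _ hA)
    fun C hC _ => ?_
  have hTC : MeasurableSet (T '' C) := T.measurableSet_image.2 hC
  have h := hT.setLIntegral_comp_preimage hTC (Kernel.measurable_coe ν.condKernel hTA)
  rw [Set.preimage_image_eq _ T.injective] at h
  rw [h, setLIntegral_condKernel hν.fst_eq hTC hTA, setLIntegral_condKernel hν.fst_eq hC hA]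
  conv_lhs => rw [← hν.map_eq]
  rw [Measure.map_apply (by fun_prop) (hTC.prod hTA)]
  congr 1
  ext ⟨x, y⟩
  simp

theorem relProd_image_prod_image [IsProbabilityMeasure μ] (hT : MeasurePreserving T μ μ)
    (hν : IsSelfJoining μ T ν) {A B : Set X} (hA : MeasurableSet A) (hB : MeasurableSet B) :
    relProd μ ν ν ((T '' A) ×ˢ (T '' B)) = relProd μ ν ν (A ×ˢ B) := by
  have hTA : MeasurableSet (T '' A) := T.measurableSet_image.2 hA
  have hTB : MeasurableSet (T '' B) := T.measurableSet_image.2 hB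
  have hm : Measurable fun x => ν.condKernel x (T '' A) * ν.condKernel x (T '' B) :=
    (Kernel.measurable_coe _ hTA).mul (Kernel.measurable_coe _ hTB)
  rw [relProd_prod hTA hTB, relProd_prod hA hB, ← hT.lintegral_comp hm]
  refine lintegral_congr_ae ?_
  filter_upwards [condKernel_image_ae hT hν hA, condKernel_image_ae hT hν hB] with x h1 h2
  rw [h1, h2]

/-- The integrand `ν_x(A) ν_x(Aᶜ)` is at most `ν_x(Aᶜ)` on `A` and at most `ν_x(A)` off `A`. -/
theorem relProd_prod_compl_le [IsProbabilityMeasure μ] (hν : IsSelfJoining μ T ν) {A : Set X}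
    (hA : MeasurableSet A) :
    relProd μ ν ν (A ×ˢ Aᶜ) ≤ ν (A ×ˢ Aᶜ) + ν (Aᶜ ×ˢ A) := by
  rw [relProd_prod hA hA.compl, ← lintegral_add_compl _ hA,
    ← setLIntegral_condKernel hν.fst_eq hA hA.compl,
    ← setLIntegral_condKernel hν.fst_eq hA.compl hA]
  gcongr with x x
  · exact mul_le_of_le_one_left' prob_le_one
  · exact mul_le_of_le_one_right' prob_le_one

theorem tendsto_relProd_prod_compl [IsProbabilityMeasure μ] {ν : ℕ → Measure (X × X)}
    [∀ i, IsFiniteMeasure (ν i)] (hν : ∀ i, IsSelfJoining μ T (ν i))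
    (hlim : JoiningsTendsto ν (diag μ)) {A : Set X} (hA : MeasurableSet A) :
    Tendsto (fun i => relProd μ (ν i) (ν i) (A ×ˢ Aᶜ)) atTop (𝓝 0) := by
  have hd : Measurable fun x : X => (x, x) := measurable_id.prodMk measurable_id
  have h1 : diag μ (A ×ˢ Aᶜ) = 0 := by
    rw [diag, Measure.map_apply hd (hA.prod hA.compl)]
    convert measure_empty (μ := μ)
    ext; simp
  have h2 : diag μ (Aᶜ ×ˢ A) = 0 := by
    rw [diag, Measure.map_apply hd (hA.compl.prod hA)]
    convert measure_empty (μ := μ)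
    ext; simp
  have h := (hlim A Aᶜ hA hA.compl).add (hlim Aᶜ A hA.compl hA)
  rw [h1, h2, add_zero] at h
  exact tendsto_of_tendsto_of_tendsto_of_le_of_le tendsto_const_nhds h (fun _ => zero_le)
    fun i => relProd_prod_compl_le (hν i) hA

/-- Jensen for `x ↦ ν_x(⋃ U b)`, whose mean is `μ(⋃ U b)`, followed by Cauchy–Schwarz over the `N`
sets inside each fibre. -/
theorem sq_measure_iUnion_le_sum_relProd [IsProbabilityMeasure μ] (hν : IsSelfJoining μ T ν)
    {N : ℕ} {U : Fin N → Set X} (hU : ∀ b, MeasurableSet (U b)) :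
    μ.real (⋃ b, U b) ^ 2 ≤ N * ∑ b, (relProd μ ν ν).real (U b ×ˢ U b) := by
  have := isProbabilityMeasure_relProd (μ := μ) hν
  have hm : ∀ b, Measurable fun x => (ν.condKernel x).real (U b) := fun b =>
    (Kernel.measurable_coe ν.condKernel (hU b)).ennreal_toReal
  have hUm : MeasurableSet (⋃ b, U b) := .iUnion hU
  have hmU : Measurable fun x => (ν.condKernel x).real (⋃ b, U b) :=
    (Kernel.measurable_coe ν.condKernel hUm).ennreal_toReal
  have hint : ∀ b, Integrable (fun x => (ν.condKernel x).real (U b) ^ 2) μ := fun b => by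
    refine Integrable.of_bound ((hm b).pow_const 2).aestronglyMeasurable 1 (ae_of_all _ fun x => ?_)
    rw [Real.norm_of_nonneg (by positivity)]
    exact pow_le_one₀ measureReal_nonneg measureReal_le_one
  have hintU : Integrable (fun x => (ν.condKernel x).real (⋃ b, U b)) μ := by
    refine Integrable.of_bound hmU.aestronglyMeasurable 1 (ae_of_all _ fun x => ?_)
    rw [Real.norm_of_nonneg measureReal_nonneg]
    exact measureReal_le_one
  have hintU2 : Integrable (fun x => (ν.condKernel x).real (⋃ b, U b) ^ 2) μ := by
    refine Integrable.of_bound (hmU.pow_const 2).aestronglyMeasurable 1 (ae_of_all _ fun x => ?_)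
    rw [Real.norm_of_nonneg (by positivity)]
    exact pow_le_one₀ measureReal_nonneg measureReal_le_one
  have h1 : ∀ b, (relProd μ ν ν).real (U b ×ˢ U b) = ∫ x, (ν.condKernel x).real (U b) ^ 2 ∂μ := by
    intro b
    rw [integral_eq_lintegral_of_nonneg_ae (ae_of_all _ fun x => by positivity)
      (hint b).aestronglyMeasurable, measureReal_def, relProd_prod (hU b) (hU b)]
    congr 1
    refine lintegral_congr fun x => ?_
    rw [ENNReal.ofReal_pow measureReal_nonneg, ofReal_measureReal, sq]
  have h2 : μ.real (⋃ b, U b) = ∫ x, (ν.condKernel x).real (⋃ b, U b) ∂μ := by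
    rw [integral_eq_lintegral_of_nonneg_ae (ae_of_all _ fun x => measureReal_nonneg)
      hintU.aestronglyMeasurable, measureReal_def, ← lintegral_condKernel hν hUm]
    congr 1
    refine lintegral_congr fun x => ?_
    rw [ofReal_measureReal]
  have h3 : μ.real (⋃ b, U b) ^ 2 ≤ ∫ x, (ν.condKernel x).real (⋃ b, U b) ^ 2 ∂μ := by
    rw [h2]
    exact (convexOn_pow 2).map_integral_le (by fun_prop) isClosed_Ici
      (ae_of_all _ fun x => measureReal_nonneg) hintU hintU2
  refine h3.trans ?_
  simp only [h1]
  rw [← integral_finsetSum _ fun b _ => hint b, ← integral_const_mul]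
  refine integral_mono hintU2 ((integrable_finsetSum _ fun b _ => hint b).const_mul _) fun x => ?_
  have h4 := sq_sum_le_card_mul_sum_sq (s := Finset.univ)
    (f := fun b => (ν.condKernel x).real (U b))
  simp only [Finset.card_univ, Fintype.card_fin] at h4
  refine le_trans ?_ h4
  gcongr
  exact measureReal_iUnion_fintype_le _

/-- The diagonal is null, and its mass under the square of `ν_x` dominates `ν_x{y}²`; so almost
every `ν_x` is atomless, and the square of an atomless measure vanishes on any graph. -/
theorem relProd_graph_eq_zero (hν : IsSelfJoining μ T ν)
    (hsing : (relProd μ ν ν).MutuallySingular (diag μ)) {S : X → X} (hS : Measurable S) :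
    relProd μ ν ν {p | S p.1 = p.2} = 0 := by
  have hd : Measurable fun x : X => (x, x) := measurable_id.prodMk measurable_id
  have hmd : MeasurableSet {p : X × X | p.1 = p.2} :=
    measurableSet_eq_fun measurable_fst measurable_snd
  have hmS : MeasurableSet {p : X × X | S p.1 = p.2} :=
    measurableSet_eq_fun (hS.comp measurable_fst) measurable_snd
  obtain ⟨R, hR, hR0, hR1⟩ := hsing
  rw [diag, Measure.map_apply hd hR.compl] at hR1
  have hdiag : relProd μ ν ν {p | p.1 = p.2} = 0 := by
    have hm : MeasurableSet ((fun x : X => (x, x)) ⁻¹' Rᶜ) := hd hR.compl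
    -- The points of the diagonal outside `R` lie over a `μ`-null set of first coordinates, hence
    -- are null because the first marginal is `μ`.
    refine measure_mono_null (t := R ∪ ((fun x : X => (x, x)) ⁻¹' Rᶜ) ×ˢ Set.univ) ?_ ?_
    · rintro ⟨x, y⟩ (rfl : x = y)
      by_cases h : (x, x) ∈ R <;> simp [h]
    · rw [measure_union_null_iff]
      exact ⟨hR0, by rw [relProd_prod_univ hν hm, hR1]⟩
  rw [relProd_apply hmd, lintegral_eq_zero_iff] at hdiag
  swap
  · have h := (Kernel.measurable_coe (ν.condKernel ×ₖ ν.condKernel) hmd)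
    simpa only [Kernel.prod_apply] using h
  rw [relProd_apply hmS]
  refine (lintegral_congr_ae ?_).trans lintegral_zero
  filter_upwards [hdiag] with x hx
  have hatom : ∀ y, ν.condKernel x {y} = 0 := by
    intro y
    have : (ν.condKernel x).prod (ν.condKernel x) ({y} ×ˢ {y}) = 0 := by
      refine measure_mono_null ?_ hx
      rintro ⟨a, b⟩ ⟨ha, hb⟩
      simp_all
    rw [Measure.prod_prod] at this
    simpa using this
  rw [Measure.prod_apply hmS]
  refine (lintegral_congr fun y => ?_).trans lintegral_zero
  convert hatom (S y) using 2
  ext z; simp [eq_comm]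

end RelProd

/-! ### Combinatorics of a Rokhlin tower. -/

theorem measurableSet_image_iterate (T : X ≃ᵐ X) (k : ℕ) {A : Set X} (hA : MeasurableSet A) :
    MeasurableSet ((T^[k]) '' A) := by
  induction k with
  | zero => simpa using hA
  | succ k ih =>
    rw [Function.iterate_succ', Set.image_comp]
    exact T.measurableSet_image.2 ih

namespace TowerPartition

variable {T : X ≃ᵐ X} (ξ : TowerPartition T)

/-- The `i`-th level `T ^ i B`, also for `i` at least the height. -/
def level (i : ℕ) : Set X := (T^[i]) '' ξ.base

/-- The union of the first `p` levels. -/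
def bottom (p : ℕ) : Set X := ⋃ i ∈ Finset.range p, ξ.level i

/-- The union of the products of levels whose indices differ by `k`. -/
def offDiag (k : ℕ) : Set (X × X) :=
  ⋃ i ∈ Finset.range (ξ.height - k), ξ.level i ×ˢ ξ.level (i + k)

theorem image_level (i : ℕ) : T '' ξ.level i = ξ.level (i + 1) := by
  rw [level, level, Function.iterate_succ', Set.image_comp]

theorem image_iterate_level (i k : ℕ) : (T^[k]) '' ξ.level i = ξ.level (i + k) := by
  rw [level, level, add_comm, Function.iterate_add, Set.image_comp]

theorem measurableSet_level (i : ℕ) : MeasurableSet (ξ.level i) :=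
  measurableSet_image_iterate T i ξ.measurableSet_base

theorem measurableSet_bottom (p : ℕ) : MeasurableSet (ξ.bottom p) :=
  Finset.measurableSet_biUnion _ fun i _ => ξ.measurableSet_level i

theorem disjoint_level {i j : ℕ} (hi : i < ξ.height) (hj : j < ξ.height) (hij : i ≠ j) :
    Disjoint (ξ.level i) (ξ.level j) :=
  ξ.pairwise_disjoint (i := .inl ⟨i, hi⟩) (j := .inl ⟨j, hj⟩) (by simpa using hij)

theorem tower_eq_bottom : ξ.tower = ξ.bottom ξ.height := by
  ext x
  simp only [tower, bottom, level, Set.mem_iUnion, Finset.mem_range, exists_prop]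
  exact ⟨fun ⟨k, hk⟩ => ⟨k, k.2, hk⟩, fun ⟨i, hi, hx⟩ => ⟨⟨i, hi⟩, hx⟩⟩

theorem measurableSet_cell (c : Fin ξ.height ⊕ Fin ξ.rest) : MeasurableSet (ξ.cell c) := by
  rcases c with k | l
  · exact ξ.measurableSet_level k
  · exact ξ.measurableSet_outer l

variable {ξ} in
theorem IsMeas.measurableSet {A : Set X} (hA : ξ.IsMeas A) : MeasurableSet A := by
  obtain ⟨S, rfl⟩ := hA
  exact MeasurableSet.biUnion S.to_countable fun c _ => ξ.measurableSet_cell c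

variable {ξ} in
theorem IsMeas.level_subset {A : Set X} (hA : ξ.IsMeas A) {i : ℕ} (hi : i < ξ.height) {x : X}
    (hx : x ∈ ξ.level i) (hxA : x ∈ A) : ξ.level i ⊆ A := by
  obtain ⟨S, rfl⟩ := hA
  simp only [Set.mem_iUnion, exists_prop] at hxA
  obtain ⟨c, hc, hxc⟩ := hxA
  have h : c = .inl ⟨i, hi⟩ := by
    by_contra hne
    exact Set.disjoint_left.1 (ξ.pairwise_disjoint hne) hxc hx
  subst h
  exact Set.subset_biUnion_of_mem (u := ξ.cell) hc

theorem disjoint_level_prod_level {i j k l : ℕ} (hi : i + k < ξ.height) (hj : j + l < ξ.height)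
    (h : i ≠ j ∨ k ≠ l) :
    Disjoint (ξ.level i ×ˢ ξ.level (i + k)) (ξ.level j ×ˢ ξ.level (j + l)) := by
  rw [Set.disjoint_prod]
  by_cases hij : i = j
  · exact .inr (ξ.disjoint_level hi hj (by omega))
  · exact .inl (ξ.disjoint_level (by omega) (by omega) hij)

variable {μ : Measure X}

theorem measureReal_level (hT : MeasurePreserving T μ μ) (i : ℕ) :
    μ.real (ξ.level i) = μ.real ξ.base := by
  induction i with
  | zero => simp [level]
  | succ i ih =>
    rw [← ih, ← image_level, ← hT.measureReal_preimage
      (T.measurableSet_image.2 (ξ.measurableSet_level i)).nullMeasurableSet,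
      Set.preimage_image_eq _ T.injective]

theorem measureReal_bottom [IsFiniteMeasure μ] (hT : MeasurePreserving T μ μ) {p : ℕ}
    (hp : p ≤ ξ.height) : μ.real (ξ.bottom p) = p * μ.real ξ.base := by
  rw [bottom, measureReal_biUnion_finset]
  · simp [measureReal_level ξ hT]
  · intro i hi j hj hij
    simp only [Finset.coe_range, Set.mem_Iio] at hi hj
    exact ξ.disjoint_level (by omega) (by omega) hij
  · exact fun i _ => ξ.measurableSet_level i

/-- Only the top level of the block and the preimage of the base can change sides, whatever `p` is.
-/
theorem measureReal_bottom_symmDiff_le [IsFiniteMeasure μ] (hT : MeasurePreserving T μ μ) (p : ℕ) :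
    μ.real (ξ.bottom p ∆ (T ⁻¹' ξ.bottom p)) ≤ 2 * μ.real ξ.base := by
  have h : ξ.bottom p ∆ (T ⁻¹' ξ.bottom p) ⊆ ξ.level (p - 1) ∪ T ⁻¹' ξ.level 0 := by
    rintro x (⟨h1, h2⟩ | ⟨h1, h2⟩)
    · simp only [bottom, Set.mem_iUnion, Finset.mem_range, exists_prop, Set.mem_preimage] at h1 h2
      obtain ⟨i, hi, hx⟩ := h1
      have hTx : T x ∈ ξ.level (i + 1) := ξ.image_level i ▸ Set.mem_image_of_mem T hx
      have : ¬ i + 1 < p := fun hlt => h2 ⟨i + 1, hlt, hTx⟩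
      obtain rfl : i = p - 1 := by omega
      exact .inl hx
    · simp only [bottom, Set.mem_iUnion, Finset.mem_range, exists_prop, Set.mem_preimage] at h1 h2
      obtain ⟨i, hi, hx⟩ := h1
      rcases i with _ | i
      · exact .inr hx
      · rw [← image_level, T.injective.mem_set_image] at hx
        exact absurd ⟨i, by omega, hx⟩ h2
  refine (measureReal_mono h).trans ((measureReal_union_le _ _).trans ?_)
  rw [hT.measureReal_preimage (ξ.measurableSet_level 0).nullMeasurableSet,
    measureReal_level ξ hT, measureReal_level ξ hT, two_mul]

open Classical in
/-- The indices `i < h - k` such that `T ^ k` maps the level `i` from `A` into its complement. -/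
def escaping (A : Set X) (k : ℕ) : Finset ℕ :=
  (Finset.range (ξ.height - k)).filter fun i => ξ.level i ⊆ A ∧ ξ.level (i + k) ⊆ Aᶜ

theorem mem_escaping {A : Set X} {k i : ℕ} :
    i ∈ ξ.escaping A k ↔ i < ξ.height - k ∧ ξ.level i ⊆ A ∧ ξ.level (i + k) ⊆ Aᶜ := by
  simp [escaping]

variable {ξ} in
theorem measureReal_bottom_inter_escaping_le [IsFiniteMeasure μ] (hT : MeasurePreserving T μ μ)
    {A : Set X} (hA : ξ.IsMeas A) (k : ℕ) :
    μ.real (ξ.bottom (ξ.height - k) ∩ A ∩ (T^[k]) ⁻¹' Aᶜ) ≤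
      (ξ.escaping A k).card * μ.real ξ.base := by
  have h : ξ.bottom (ξ.height - k) ∩ A ∩ (T^[k]) ⁻¹' Aᶜ ⊆ ⋃ i ∈ ξ.escaping A k, ξ.level i := by
    rintro x ⟨⟨h1, h2⟩, h3⟩
    simp only [bottom, Set.mem_iUnion, exists_prop] at h1 ⊢
    obtain ⟨i, hi, hx⟩ := h1
    have hi' := Finset.mem_range.1 hi
    refine ⟨i, ξ.mem_escaping.2 ⟨hi', hA.level_subset (by omega) hx h2, ?_⟩, hx⟩
    intro y hy hyA
    refine h3 (hA.level_subset (by omega) hy hyA ?_)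
    rw [← image_iterate_level]
    exact Set.mem_image_of_mem _ hx
  refine (measureReal_mono h (measure_ne_top _ _)).trans ((measureReal_biUnion_finset_le _ _).trans ?_)
  simp [measureReal_level ξ hT]

/-! ### The square of a joining on the levels of a tower. -/

section Joining

variable [StandardBorelSpace X] [Nonempty X] {ν : Measure (X × X)} [IsFiniteMeasure ν]

/-- If `(x, T^k z)` lies on the off-diagonal, then `x` and `z` share a level, which `A'` cannot cut.
If `A` separates them, one of the two is in `A ∆ A'`, and both marginals are `μ`. -/
theorem relProd_offDiag_inter_le (hT : MeasurePreserving T μ μ) (hν : IsSelfJoining μ T ν)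
    (k : ℕ) {A A' : Set X} (hA : MeasurableSet A) (hA' : ξ.IsMeas A') :
    relProd μ ν ν (ξ.offDiag k ∩ {p | ¬ (p.1 ∈ A ↔ p.2 ∈ (T^[k]) '' A)}) ≤ 2 * μ (A ∆ A') := by
  have hm : MeasurableSet (A ∆ A') := hA.symmDiff hA'.measurableSet
  have hmk : MeasurableSet ((T^[k]) '' (A ∆ A')) := measurableSet_image_iterate T k hm
  have hsub : ξ.offDiag k ∩ {p | ¬ (p.1 ∈ A ↔ p.2 ∈ (T^[k]) '' A)} ⊆
      (A ∆ A') ×ˢ Set.univ ∪ Set.univ ×ˢ ((T^[k]) '' (A ∆ A')) := by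
    rintro ⟨x, y⟩ ⟨hD, hne⟩
    simp only [offDiag, Set.mem_iUnion, Finset.mem_range, Set.mem_prod, exists_prop] at hD
    obtain ⟨i, hi, hx, hy⟩ := hD
    rw [← image_iterate_level] at hy
    obtain ⟨z, hz, rfl⟩ := hy
    have hi' : i < ξ.height := by omega
    have h1 : x ∈ A' ↔ z ∈ A' := ⟨fun h => hA'.level_subset hi' hx h hz,
      fun h => hA'.level_subset hi' hz h hx⟩
    simp only [Set.mem_ofPred_eq, (T.injective.iterate k).mem_set_image, Set.mem_union,
      Set.mem_prod, Set.mem_univ, and_true, true_and, Set.mem_symmDiff] at hne ⊢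
    tauto
  refine (measure_mono hsub).trans ((measure_union_le _ _).trans ?_)
  rw [relProd_prod_univ hν hm, relProd_univ_prod hν hmk, two_mul,
    ← (hT.iterate k).measure_preimage hmk.nullMeasurableSet,
    Set.preimage_image_eq _ (T.injective.iterate k)]

variable [IsProbabilityMeasure μ]

theorem relProd_level_prod_level (hT : MeasurePreserving T μ μ) (hν : IsSelfJoining μ T ν)
    (i k : ℕ) :
    (relProd μ ν ν).real (ξ.level i ×ˢ ξ.level (i + k)) =
      (relProd μ ν ν).real (ξ.base ×ˢ ξ.level k) := by
  induction i with
  | zero => simp [level]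
  | succ i ih =>
    rw [← ih, ← image_level, show i + 1 + k = i + k + 1 by omega, ← image_level, measureReal_def,
      relProd_image_prod_image hT hν (ξ.measurableSet_level _) (ξ.measurableSet_level _),
      measureReal_def]

theorem relProd_offDiag (hT : MeasurePreserving T μ μ) (hν : IsSelfJoining μ T ν) (k : ℕ) :
    (relProd μ ν ν).real (ξ.offDiag k) =
      (ξ.height - k : ℕ) * (relProd μ ν ν).real (ξ.base ×ˢ ξ.level k) := by
  have := isProbabilityMeasure_relProd (μ := μ) hν
  rw [offDiag, measureReal_biUnion_finset]
  · simp [relProd_level_prod_level ξ hT hν]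
  · intro i hi j hj hij
    simp only [Finset.coe_range, Set.mem_Iio] at hi hj
    exact ξ.disjoint_level_prod_level (by omega) (by omega) (.inl hij)
  · exact fun i _ => (ξ.measurableSet_level _).prod (ξ.measurableSet_level _)

/-- The level products indexed by escaping pairs `(k, i)` are pairwise disjoint and all lie in `A ×
Aᶜ`. -/
theorem sum_card_escaping_mul_le (hT : MeasurePreserving T μ μ) (hν : IsSelfJoining μ T ν)
    (A : Set X) (F : Finset ℕ) :
    ∑ k ∈ F, (ξ.escaping A k).card * (relProd μ ν ν).real (ξ.base ×ˢ ξ.level k) ≤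
      (relProd μ ν ν).real (A ×ˢ Aᶜ) := by
  have := isProbabilityMeasure_relProd (μ := μ) hν
  have h1 : ∑ k ∈ F, (ξ.escaping A k).card * (relProd μ ν ν).real (ξ.base ×ˢ ξ.level k) =
      ∑ p ∈ F.sigma (ξ.escaping A), (relProd μ ν ν).real (ξ.level p.2 ×ˢ ξ.level (p.2 + p.1)) := by
    rw [Finset.sum_sigma]
    refine Finset.sum_congr rfl fun k _ => ?_
    simp [relProd_level_prod_level ξ hT hν]
  rw [h1, ← measureReal_biUnion_finset]
  · refine measureReal_mono (Set.iUnion₂_subset fun p hp => ?_)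
    obtain ⟨-, h2, h3⟩ := ξ.mem_escaping.1 (Finset.mem_sigma.1 hp).2
    exact Set.prod_mono h2 h3
  · rintro ⟨k, i⟩ hp ⟨l, j⟩ hq hne
    have hi := (ξ.mem_escaping.1 (Finset.mem_sigma.1 hp).2).1
    have hj := (ξ.mem_escaping.1 (Finset.mem_sigma.1 hq).2).1
    dsimp only at hi hj
    dsimp only [Function.onFun]
    refine ξ.disjoint_level_prod_level (by omega) (by omega) ?_
    by_contra! h
    obtain ⟨rfl, rfl⟩ := h
    exact hne rfl
  · exact fun p _ => (ξ.measurableSet_level _).prod (ξ.measurableSet_level _)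

/-- Cut the tower into `N` blocks of at most `s` consecutive levels: two points that are
conditionally independent fall into the same block with probability at least `μ (U) ^ 2 / N`. -/
theorem sq_measureReal_tower_le (hT : MeasurePreserving T μ μ) (hν : IsSelfJoining μ T ν)
    {N s : ℕ} (hNs : ξ.height ≤ N * s) :
    μ.real ξ.tower ^ 2 ≤
      N * (2 * ∑ k ∈ Finset.range s, (relProd μ ν ν).real (ξ.offDiag k)) := by
  have := isProbabilityMeasure_relProd (μ := μ) hν
  set m := relProd μ ν ν
  set I : Fin N → Finset ℕ := fun b => (Finset.range ξ.height).filter fun i => i / s = b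
  set U : Fin N → Set X := fun b => ⋃ i ∈ I b, ξ.level i
  have hU : ∀ b, MeasurableSet (U b) := fun b =>
    Finset.measurableSet_biUnion _ fun i _ => ξ.measurableSet_level i
  have htower : ξ.tower ⊆ ⋃ b, U b := by
    rw [tower_eq_bottom]
    refine Set.iUnion₂_subset fun i hi => ?_
    have hi' := Finset.mem_range.1 hi
    have hb : i / s < N := Nat.div_lt_of_lt_mul (by rw [mul_comm]; omega)
    exact Set.subset_iUnion_of_subset ⟨i / s, hb⟩ (Set.subset_biUnion_of_mem (u := ξ.level)
      (Finset.mem_coe.2 (Finset.mem_filter.2 ⟨hi, rfl⟩)))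
  have hdisj : Pairwise (Function.onFun Disjoint fun b => U b ×ˢ U b) := by
    intro b c hbc
    rw [Function.onFun, Set.disjoint_prod]
    left
    simp only [U, Set.disjoint_iUnion_left, Set.disjoint_iUnion_right]
    intro i hi j hj
    simp only [I, Finset.mem_filter, Finset.mem_range] at hi hj
    refine ξ.disjoint_level (by omega) (by omega) ?_
    rintro rfl
    exact hbc (Fin.ext (by omega))
  -- Pairs below the diagonal weigh no more than those above, by symmetry of the square; this is the
  -- factor `2` in the bound.
  have hswap : ∀ k, m.real (⋃ i ∈ Finset.range (ξ.height - k), ξ.level (i + k) ×ˢ ξ.level i) ≤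
      m.real (ξ.offDiag k) := by
    intro k
    rw [relProd_offDiag ξ hT hν]
    refine (measureReal_biUnion_finset_le _ _).trans (le_of_eq ?_)
    rw [← Finset.card_range (ξ.height - k), ← nsmul_eq_mul, ← Finset.sum_const,
      Finset.card_range]
    refine Finset.sum_congr rfl fun i _ => ?_
    rw [← relProd_level_prod_level ξ hT hν i k, measureReal_def,
      relProd_prod_swap (ξ.measurableSet_level _) (ξ.measurableSet_level _), measureReal_def]
  have hcover : (⋃ b, U b ×ˢ U b) ⊆ ⋃ k ∈ Finset.range s,
      (ξ.offDiag k ∪ ⋃ i ∈ Finset.range (ξ.height - k), ξ.level (i + k) ×ˢ ξ.level i) := by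
    rintro ⟨x, y⟩ hxy
    simp only [U, I, offDiag, Set.mem_iUnion, Set.mem_prod, Finset.mem_filter, Finset.mem_range,
      exists_prop, Set.mem_union] at hxy ⊢
    obtain ⟨b, ⟨i, ⟨hi, hib⟩, hx⟩, j, ⟨hj, hjb⟩, hy⟩ := hxy
    have hs : 0 < s := Nat.pos_of_ne_zero (by rintro rfl; omega)
    have hi1 := Nat.div_add_mod i s
    have hj1 := Nat.div_add_mod j s
    have hi2 := Nat.mod_lt i hs
    have hj2 := Nat.mod_lt j hs
    rw [hib] at hi1
    rw [hjb] at hj1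
    rcases le_total i j with hij | hij
    · refine ⟨j - i, by omega, .inl ⟨i, by omega, hx, ?_⟩⟩
      rwa [Nat.add_sub_cancel' hij]
    · refine ⟨i - j, by omega, .inr ⟨j, by omega, ?_, hy⟩⟩
      rwa [Nat.add_sub_cancel' hij]
  calc μ.real ξ.tower ^ 2 ≤ μ.real (⋃ b, U b) ^ 2 := by gcongr; exact measure_ne_top _ _
    _ ≤ N * ∑ b, m.real (U b ×ˢ U b) := sq_measure_iUnion_le_sum_relProd hν hU
    _ = N * m.real (⋃ b, U b ×ˢ U b) := by
        rw [measureReal_iUnion_fintype hdisj fun b => (hU b).prod (hU b)]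
    _ ≤ N * (2 * ∑ k ∈ Finset.range s, m.real (ξ.offDiag k)) := by
        gcongr
        refine (measureReal_mono hcover (measure_ne_top _ _)).trans ((measureReal_biUnion_finset_le _ _).trans ?_)
        rw [Finset.mul_sum]
        refine Finset.sum_le_sum fun k _ => ?_
        linarith [measureReal_union_le (μ := m) (ξ.offDiag k)
          (⋃ i ∈ Finset.range (ξ.height - k), ξ.level (i + k) ×ˢ ξ.level i), hswap k]

/-- One-block Cauchy–Schwarz gives `m(B × B) ≥ μ(B)²`, and the main diagonal consists of `h` such
squares. This will force `μ(B) → 0`. -/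
theorem measureReal_tower_mul_base_le (hT : MeasurePreserving T μ μ) (hν : IsSelfJoining μ T ν) :
    μ.real ξ.tower * μ.real ξ.base ≤ (relProd μ ν ν).real (ξ.offDiag 0) := by
  have h := sq_measure_iUnion_le_sum_relProd hν (N := 1) (U := fun _ => ξ.base)
    fun _ => ξ.measurableSet_base
  rw [Set.iUnion_const] at h
  rw [relProd_offDiag ξ hT hν, tower_eq_bottom, measureReal_bottom ξ hT le_rfl, mul_assoc]
  simp only [Nat.sub_zero]
  gcongr
  simpa [level, sq] using h

/-- Cells shrink to points, so the `k`-th off-diagonal shrinks to the graph of `T ^ k`. -/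
theorem tendsto_relProd_offDiag (hT : MeasurePreserving T μ μ) (hν : IsSelfJoining μ T ν)
    (hsing : (relProd μ ν ν).MutuallySingular (diag μ)) {ξ : ℕ → TowerPartition T}
    (hξ : TendsToPoints μ ξ) (k : ℕ) :
    Tendsto (fun j => relProd μ ν ν ((ξ j).offDiag k)) atTop (𝓝 0) := by
  have := isProbabilityMeasure_relProd (μ := μ) hν
  obtain ⟨A, hA, hsep⟩ := exists_seq_separating X (p := MeasurableSet) .empty Set.univ
  set S : ℕ → Set (X × X) := fun n => {p | ¬ (p.1 ∈ A n ↔ p.2 ∈ (T^[k]) '' A n)}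
  have hS : ∀ n, MeasurableSet (S n) := fun n =>
    (((hA n).mem.comp measurable_fst).iff
      ((measurableSet_image_iterate T k (hA n)).mem.comp measurable_snd)).not.setOf
  -- A pair `(x, T^k z)` that no separating set distinguishes has `x = z`, so it is on the graph of
  -- `T^k`.
  have hgraph : (⋂ n, (Set.accumulate S n)ᶜ) ⊆ {p | T^[k] p.1 = p.2} := by
    rintro ⟨x, y⟩ hxy
    obtain ⟨z, rfl⟩ := T.surjective.iterate k y
    have h : ∀ n, x ∈ A n ↔ z ∈ A n := by
      intro n
      have h1 := Set.mem_iInter.1 hxy n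
      have h2 : (x, (T^[k]) z) ∉ S n := fun h => h1 (Set.subset_accumulate h)
      simpa only [S, Set.mem_ofPred_eq, (T.injective.iterate k).mem_set_image, not_not] using h2
    exact congrArg _ (hsep x trivial z trivial h)
  have hacc : ∀ n, MeasurableSet (Set.accumulate S n) := fun n => by
    rw [Set.accumulate_def]
    exact MeasurableSet.biUnion (Set.to_countable _) fun i _ => hS i
  have hlim : Tendsto (fun n => relProd μ ν ν (Set.accumulate S n)ᶜ) atTop (𝓝 0) := by
    have h := tendsto_measure_iInter_atTop (μ := relProd μ ν ν)
      (s := fun n => (Set.accumulate S n)ᶜ) (fun n => (hacc n).compl.nullMeasurableSet)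
      (fun m n hmn => Set.compl_subset_compl.2 (Set.monotone_accumulate hmn))
      ⟨0, measure_ne_top _ _⟩
    rwa [measure_mono_null hgraph (relProd_graph_eq_zero hν hsing (T.measurable.iterate k))] at h
  choose A' hA' hlimA using fun n => hξ (A n) (hA n)
  rw [ENNReal.tendsto_nhds_zero] at hlim ⊢
  intro ε hε
  obtain ⟨n, hn⟩ := (hlim (ε / 2) (ENNReal.half_pos hε.ne')).exists
  have hsum : Tendsto (fun j => ∑ i ∈ Finset.range (n + 1), 2 * μ (A i ∆ A' i j)) atTop
      (𝓝 0) := by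
    have h := tendsto_finsetSum (Finset.range (n + 1)) fun i _ =>
      ENNReal.Tendsto.const_mul (a := 2) (hlimA i) (.inr (by simp))
    simpa using h
  rw [ENNReal.tendsto_nhds_zero] at hsum
  filter_upwards [hsum (ε / 2) (ENNReal.half_pos hε.ne')] with j hj
  have hsub : (ξ j).offDiag k ⊆
      (Set.accumulate S n)ᶜ ∪ ⋃ i ∈ Finset.range (n + 1), (ξ j).offDiag k ∩ S i := by
    intro p hp
    by_cases h : p ∈ Set.accumulate S n
    · obtain ⟨i, hi, hpi⟩ := Set.mem_accumulate.1 h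
      exact .inr (Set.mem_biUnion (Finset.mem_coe.2 (Finset.mem_range.2 (by omega))) ⟨hp, hpi⟩)
    · exact .inl h
  calc _ ≤ _ := measure_mono hsub
    _ ≤ ε / 2 + ∑ i ∈ Finset.range (n + 1), 2 * μ (A i ∆ A' i j) := by
        refine (measure_union_le _ _).trans (add_le_add hn ?_)
        refine (measure_biUnion_finset_le _ _).trans (Finset.sum_le_sum fun i _ => ?_)
        exact (ξ j).relProd_offDiag_inter_le hT hν k (hA i) (hA' i j)
    _ ≤ ε / 2 + ε / 2 := by gcongr
    _ = ε := ENNReal.add_halves ε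

end Joining

end TowerPartition

/-! ### Ergodicity: almost invariant sets are almost independent of a fixed set. -/

section Ergodic

variable {μ : Measure X} {T : X ≃ᵐ X}

theorem koopman_pow_indicator [IsProbabilityMeasure μ] (hT : MeasurePreserving T μ μ) (n : ℕ)
    {A : Set X} (hA : MeasurableSet A) :
    (koopman hT ^ n) (indicatorConstLp 2 hA (measure_ne_top μ A) 1) =
      indicatorConstLp 2 ((T.measurable.iterate n) hA) (measure_ne_top μ _) 1 := by
  induction n with
  | zero => rfl
  | succ n ih =>
    rw [pow_succ', mul_apply_eq_comp, ih]
    exact Lp.indicatorConstLp_compMeasurePreserving _ _ _ hT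

theorem inner_indicator_indicator [IsProbabilityMeasure μ] {A B : Set X} (hA : MeasurableSet A)
    (hB : MeasurableSet B) :
    inner ℝ (indicatorConstLp 2 hA (measure_ne_top μ A) (1 : ℝ))
      (indicatorConstLp 2 hB (measure_ne_top μ B) 1) = μ.real (A ∩ B) := by
  rw [L2.inner_indicatorConstLp_one, setIntegral_congr_ae hA (g := B.indicator fun _ => (1 : ℝ))]
  · rw [setIntegral_indicator hB]; simp
  · filter_upwards [indicatorConstLp_coeFn (p := 2) (hs := hB) (hμs := measure_ne_top μ B)
      (c := (1 : ℝ))] with x hx _ using hx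

theorem inner_koopman_pow_indicator [IsProbabilityMeasure μ] (hT : MeasurePreserving T μ μ)
    (n : ℕ) {A B : Set X} (hA : MeasurableSet A) (hB : MeasurableSet B) :
    inner ℝ ((koopman hT ^ n) (indicatorConstLp 2 hA (measure_ne_top μ A) 1))
      (indicatorConstLp 2 hB (measure_ne_top μ B) (1 : ℝ)) = μ.real (T^[n] ⁻¹' A ∩ B) := by
  rw [koopman_pow_indicator hT n hA]
  exact inner_indicator_indicator _ hB

theorem norm_koopman_le (hT : MeasurePreserving T μ μ) : ‖koopman hT‖ ≤ 1 :=
  LinearIsometry.norm_toContinuousLinearMap_le _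

theorem abs_measureReal_inter_preimage_iterate_sub_le [IsProbabilityMeasure μ]
    (hT : MeasurePreserving T μ μ) {A E : Set X} (hA : MeasurableSet A) (hE : MeasurableSet E)
    (n : ℕ) :
    |μ.real (T^[n] ⁻¹' A ∩ E) - μ.real (A ∩ E)| ≤ n * μ.real (E ∆ (T ⁻¹' E)) := by
  induction n with
  | zero => simp
  | succ n ih =>
    have hAn : MeasurableSet (T^[n] ⁻¹' A) := T.measurable.iterate n hA
    have h1 : μ.real (T^[n] ⁻¹' A ∩ E) = μ.real (T^[n + 1] ⁻¹' A ∩ T ⁻¹' E) := by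
      rw [← hT.measureReal_preimage (hAn.inter hE).nullMeasurableSet]
      rfl
    have h2 : |μ.real (T^[n + 1] ⁻¹' A ∩ E) - μ.real (T^[n + 1] ⁻¹' A ∩ T ⁻¹' E)| ≤
        μ.real (E ∆ (T ⁻¹' E)) := by
      rw [abs_le]
      have h3 : μ.real (T^[n + 1] ⁻¹' A ∩ E) ≤
          μ.real (T^[n + 1] ⁻¹' A ∩ T ⁻¹' E) + μ.real (E ∆ (T ⁻¹' E)) := by
        refine (measureReal_mono ?_).trans (measureReal_union_le _ _)
        intro x hx
        by_cases h : x ∈ T ⁻¹' E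
        · exact .inl ⟨hx.1, h⟩
        · exact .inr (.inl ⟨hx.2, h⟩)
      have h4 : μ.real (T^[n + 1] ⁻¹' A ∩ T ⁻¹' E) ≤
          μ.real (T^[n + 1] ⁻¹' A ∩ E) + μ.real (E ∆ (T ⁻¹' E)) := by
        refine (measureReal_mono ?_).trans (measureReal_union_le _ _)
        intro x hx
        by_cases h : x ∈ E
        · exact .inl ⟨hx.1, h⟩
        · exact .inr (.inr ⟨hx.2, h⟩)
      constructor <;> linarith
    rw [← h1] at h2
    calc _ ≤ |μ.real (T^[n + 1] ⁻¹' A ∩ E) - μ.real (T^[n] ⁻¹' A ∩ E)|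
          + |μ.real (T^[n] ⁻¹' A ∩ E) - μ.real (A ∩ E)| := abs_sub_le _ _ _
      _ ≤ _ := by push_cast; linarith

/-- Almost invariant sets are almost independent of a given set. -/
theorem exists_forall_abs_measureReal_inter_sub_le [IsProbabilityMeasure μ] (hT : Ergodic T μ)
    {A : Set X} (hA : MeasurableSet A) {δ : ℝ} (hδ : 0 < δ) :
    ∃ η : ℝ, 0 < η ∧ ∀ E : Set X, MeasurableSet E → μ.real (E ∆ (T ⁻¹' E)) ≤ η →
      |μ.real (A ∩ E) - μ.real A * μ.real E| ≤ δ := by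
  set U := koopman hT.toMeasurePreserving
  set f : Lp ℝ 2 μ := indicatorConstLp 2 hA (measure_ne_top μ A) 1 with hf
  -- Mean ergodic theorem: averaging over `N` shifts changes the pairing with an almost invariant
  -- `E` by little, while the average itself is close to a constant. `N` depends only on `A` and
  -- `δ`.
  have hlim := U.tendsto_birkhoffAverage_orthogonalProjection
    (norm_koopman_le hT.toMeasurePreserving) f
  set g := (U.eqLocus (1 : Lp ℝ 2 μ →L[ℝ] Lp ℝ 2 μ)).orthogonalProjectionOnto f
  have hUg : U (g : Lp ℝ 2 μ) = g := g.2
  obtain ⟨c, hc⟩ : ∃ c : ℝ, (g : Lp ℝ 2 μ) =ᵐ[μ] fun _ => c := by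
    refine hT.ae_eq_const_of_ae_eq_comp_ae (Lp.aestronglyMeasurable _) ?_
    have h := Lp.coeFn_compMeasurePreserving (g : Lp ℝ 2 μ) hT.toMeasurePreserving
    have h' : Lp.compMeasurePreserving T hT.toMeasurePreserving (g : Lp ℝ 2 μ) = g := hUg
    rw [h'] at h
    exact h.symm
  obtain ⟨N, hN1, hN⟩ : ∃ N : ℕ, 1 ≤ N ∧
      ‖birkhoffAverage ℝ U _root_.id N f - g‖ < δ / 3 := by
    have h := (Metric.tendsto_nhds.1 hlim (δ / 3) (by positivity)).and (eventually_ge_atTop 1)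
    obtain ⟨N, h1, h2⟩ := h.exists
    exact ⟨N, h2, by rwa [dist_eq_norm] at h1⟩
  have hNpos : (0 : ℝ) < N := by exact_mod_cast hN1
  have hmain : ∀ E : Set X, MeasurableSet E →
      |μ.real (A ∩ E) - c * μ.real E| ≤ N * μ.real (E ∆ (T ⁻¹' E)) + δ / 3 := by
    intro E hE
    set e : Lp ℝ 2 μ := indicatorConstLp 2 hE (measure_ne_top μ E) 1 with he
    have h1 : inner ℝ (g : Lp ℝ 2 μ) e = c * μ.real E := by
      rw [real_inner_comm, L2.inner_indicatorConstLp_one,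
        setIntegral_congr_ae hE (g := fun _ => c) (by filter_upwards [hc] with x hx _ using hx)]
      simp [mul_comm]
    have h2 : inner ℝ (birkhoffAverage ℝ U _root_.id N f) e =
        (N : ℝ)⁻¹ * ∑ n ∈ Finset.range N, μ.real (T^[n] ⁻¹' A ∩ E) := by
      rw [birkhoffAverage, real_inner_smul_left, birkhoffSum, sum_inner]
      congr 1
      refine Finset.sum_congr rfl fun n hn => ?_
      rw [← inner_koopman_pow_indicator hT.toMeasurePreserving n hA hE, id_eq]
      congr 1
      clear hn
      induction n with
      | zero => rfl
      | succ n ih => rw [Function.iterate_succ_apply', ih, pow_succ', mul_apply_eq_comp]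
    have h3 : |inner ℝ (birkhoffAverage ℝ U _root_.id N f - g) e| ≤ δ / 3 := by
      refine (abs_real_inner_le_norm _ _).trans ?_
      have he1 : ‖e‖ ≤ 1 := by
        have : ‖e‖ ^ 2 ≤ 1 := by
          rw [← real_inner_self_eq_norm_sq, he, inner_indicator_indicator]
          exact measureReal_le_one
        nlinarith [norm_nonneg e]
      nlinarith [norm_nonneg (birkhoffAverage ℝ U _root_.id N f - g), norm_nonneg e]
    rw [inner_sub_left, h1, h2] at h3
    have h4 : |(N : ℝ)⁻¹ * ∑ n ∈ Finset.range N, μ.real (T^[n] ⁻¹' A ∩ E) - μ.real (A ∩ E)| ≤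
        N * μ.real (E ∆ (T ⁻¹' E)) := by
      have h5 : (N : ℝ)⁻¹ * ∑ n ∈ Finset.range N, μ.real (T^[n] ⁻¹' A ∩ E) - μ.real (A ∩ E) =
          (N : ℝ)⁻¹ * ∑ n ∈ Finset.range N, (μ.real (T^[n] ⁻¹' A ∩ E) - μ.real (A ∩ E)) := by
        rw [Finset.sum_sub_distrib, Finset.sum_const, Finset.card_range, nsmul_eq_mul]
        field_simp
      rw [h5, abs_mul, abs_of_pos (inv_pos.2 hNpos), inv_mul_le_iff₀ hNpos]
      refine (Finset.abs_sum_le_sum_abs _ _).trans ?_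
      calc _ ≤ ∑ n ∈ Finset.range N, (N : ℝ) * μ.real (E ∆ (T ⁻¹' E)) := by
            refine Finset.sum_le_sum fun n hn => ?_
            refine (abs_measureReal_inter_preimage_iterate_sub_le
              hT.toMeasurePreserving hA hE n).trans ?_
            gcongr
            exact (Finset.mem_range.1 hn).le
        _ = _ := by rw [Finset.sum_const, Finset.card_range, nsmul_eq_mul]
    rw [abs_le] at h3 h4 ⊢
    constructor <;> linarith
  -- The exactly invariant set `E = X` identifies the constant up to `δ / 3`.
  have hcA : |μ.real A - c| ≤ δ / 3 := by
    simpa using hmain Set.univ .univ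
  refine ⟨δ / (3 * N), by positivity, fun E hE hη => ?_⟩
  have h1 := hmain E hE
  have h2 : N * μ.real (E ∆ (T ⁻¹' E)) ≤ δ / 3 := by
    calc _ ≤ N * (δ / (3 * N)) := by gcongr
      _ = δ / 3 := by field_simp
  have h3 : |μ.real A - c| * μ.real E ≤ δ / 3 :=
    (mul_le_of_le_one_right (abs_nonneg _) measureReal_le_one).trans hcA
  have h4 : μ.real (A ∩ E) - μ.real A * μ.real E =
      (μ.real (A ∩ E) - c * μ.real E) - (μ.real A - c) * μ.real E := by ring
  rw [h4]
  refine (abs_sub _ _).trans ?_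
  rw [abs_mul, abs_of_nonneg (measureReal_nonneg (μ := μ) (s := E))]
  linarith

end Ergodic

/-! ### Weak operator compactness and positivity. -/

section WeakLimit

/-- Tychonoff on pairs from a countable dense set gives the subsequence; the uniform norm bound
extends convergence to all pairs, and the limit form is bounded and bilinear, hence given by an
operator. -/
theorem exists_subseq_tendsto_inner {H : Type*} [NormedAddCommGroup H] [InnerProductSpace ℝ H]
    [CompleteSpace H] [TopologicalSpace.SeparableSpace H] (V : ℕ → H →L[ℝ] H)
    (hV : ∀ i, ‖V i‖ ≤ 1) :
    ∃ φ : ℕ → ℕ, StrictMono φ ∧ ∃ P : H →L[ℝ] H, ∀ f g : H,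
      Tendsto (fun i => inner ℝ (V (φ i) f) g) atTop (𝓝 (inner ℝ (P f) g)) := by
  have hbound : ∀ i f g, |inner ℝ (V i f) g| ≤ ‖f‖ * ‖g‖ := fun i f g => by
    refine (abs_real_inner_le_norm _ _).trans ?_
    gcongr
    simpa using (V i).le_of_opNorm_le (hV i) f
  set d := TopologicalSpace.denseSeq H
  have hd : DenseRange d := TopologicalSpace.denseRange_denseSeq H
  set F : ℕ → (ℕ × ℕ → ℝ) := fun i p => inner ℝ (V i (d p.1)) (d p.2)
  have hK : IsCompact (Set.univ.pi fun p : ℕ × ℕ =>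
      Set.Icc (-(‖d p.1‖ * ‖d p.2‖)) (‖d p.1‖ * ‖d p.2‖)) :=
    isCompact_univ_pi fun p => isCompact_Icc
  obtain ⟨a, -, φ, hφ, ha⟩ := hK.tendsto_subseq (x := F)
    fun i p _ => abs_le.1 (hbound i _ _)
  have hcauchy : ∀ f g, CauchySeq fun i => inner ℝ (V (φ i) f) g := by
    intro f g
    rw [Metric.cauchySeq_iff']
    intro ε hε
    obtain ⟨m, hm⟩ : ∃ m, ‖f - d m‖ < ε / (8 * (‖g‖ + 1)) := by
      obtain ⟨m, hm⟩ := hd.exists_dist_lt f (ε := ε / (8 * (‖g‖ + 1))) (by positivity)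
      exact ⟨m, by rwa [← dist_eq_norm]⟩
    obtain ⟨n, hn⟩ : ∃ n, ‖g - d n‖ < ε / (8 * (‖d m‖ + 1)) := by
      obtain ⟨m, hm⟩ := hd.exists_dist_lt g (ε := ε / (8 * (‖d m‖ + 1))) (by positivity)
      exact ⟨m, by rwa [← dist_eq_norm]⟩
    have hclose : ∀ i, |inner ℝ (V i f) g - inner ℝ (V i (d m)) (d n)| ≤ ε / 4 := by
      intro i
      have h1 : inner ℝ (V i f) g - inner ℝ (V i (d m)) (d n) =
          inner ℝ (V i (f - d m)) g + inner ℝ (V i (d m)) (g - d n) := by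
        simp only [map_sub, inner_sub_left, inner_sub_right]
        ring
      have h2 : ‖f - d m‖ * ‖g‖ ≤ ε / 8 := by
        calc _ ≤ ε / (8 * (‖g‖ + 1)) * (‖g‖ + 1) := by gcongr; linarith
          _ = _ := by field_simp
      have h3 : ‖d m‖ * ‖g - d n‖ ≤ ε / 8 := by
        calc _ ≤ (‖d m‖ + 1) * (ε / (8 * (‖d m‖ + 1))) := by gcongr; linarith
          _ = _ := by field_simp
      rw [h1]
      refine (abs_add_le _ _).trans ?_
      linarith [hbound i (f - d m) g, hbound i (d m) (g - d n)]
    have hc := ((tendsto_pi_nhds.1 ha) (m, n)).cauchySeq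
    obtain ⟨N, hN⟩ := Metric.cauchySeq_iff'.1 hc (ε / 4) (by positivity)
    refine ⟨N, fun k hk => ?_⟩
    have h1 := hN k hk
    have h2 := hclose (φ k)
    have h3 := hclose (φ N)
    simp only [Function.comp_apply, F, Real.dist_eq, abs_lt, abs_le] at *
    constructor <;> linarith
  choose L hL using fun f g => cauchySeq_tendsto_of_complete (hcauchy f g)
  have hLb : ∀ f g, ‖L f g‖ ≤ 1 * ‖f‖ * ‖g‖ := fun f g => by
    rw [one_mul]
    exact le_of_tendsto (hL f g).norm (Eventually.of_forall fun i => hbound _ f g)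
  let B : H →L[ℝ] H →L[ℝ] ℝ := LinearMap.mkContinuous₂ (LinearMap.mk₂ ℝ L
    (fun f f' g => tendsto_nhds_unique (hL _ _) (by
      simpa only [map_add, inner_add_left] using (hL f g).add (hL f' g)))
    (fun c f g => tendsto_nhds_unique (hL _ _) (by
      simpa only [map_smul, real_inner_smul_left, smul_eq_mul] using (hL f g).const_mul c))
    (fun f g g' => tendsto_nhds_unique (hL _ _) (by
      simpa only [inner_add_right] using (hL f g).add (hL f g')))
    (fun c f g => tendsto_nhds_unique (hL _ _) (by
      simpa only [real_inner_smul_right, smul_eq_mul] using (hL f g).const_mul c))) 1 hLb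
  refine ⟨φ, hφ, InnerProductSpace.continuousLinearMapOfBilin (𝕜 := ℝ) B, fun f g => ?_⟩
  rw [InnerProductSpace.continuousLinearMapOfBilin_apply]
  exact hL f g

/-- Positivity of an operator on `L²` can be tested on indicators. -/
theorem isPositiveOp_of_inner_indicator_nonneg {μ : Measure X} [IsProbabilityMeasure μ]
    (Q : Lp ℝ 2 μ →L[ℝ] Lp ℝ 2 μ)
    (hQ : ∀ (A B : Set X) (hA : MeasurableSet A) (hB : MeasurableSet B),
      0 ≤ inner ℝ (Q (indicatorConstLp 2 hA (measure_ne_top μ A) 1))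
        (indicatorConstLp 2 hB (measure_ne_top μ B) (1 : ℝ))) :
    IsPositiveOp Q := by
  have key : ∀ g : Lp ℝ 2 μ, (∀ (A : Set X) (hA : MeasurableSet A),
      0 ≤ inner ℝ (indicatorConstLp 2 hA (measure_ne_top μ A) (1 : ℝ)) g) → 0 ≤ g := by
    intro g hg
    rw [← Lp.coeFn_nonneg]
    refine ae_nonneg_of_forall_setIntegral_nonneg
      ((Lp.memLp g).integrable (by norm_num)) fun A hA _ => ?_
    have := hg A hA
    rwa [L2.inner_indicatorConstLp_one] at this
  intro f hf
  refine key _ fun B hB => ?_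
  -- The adjoint sends indicators to nonnegative functions, which frees the first argument from
  -- being an indicator.
  have h := key (ContinuousLinearMap.adjoint Q (indicatorConstLp 2 hB (measure_ne_top μ B) 1))
    fun A hA => by
      rw [ContinuousLinearMap.adjoint_inner_right]
      exact hQ A B hA hB
  rw [← ContinuousLinearMap.adjoint_inner_left, L2.inner_def]
  refine integral_nonneg_of_ae ?_
  filter_upwards [(Lp.coeFn_nonneg _).2 h, (Lp.coeFn_nonneg _).2 hf] with x h1 h2
  simpa using mul_nonneg h2 h1

end WeakLimit

/-! ### Finding return times inside towers. -/

section ReturnTimes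

theorem tendsto_measureReal_zero {Y : Type*} [MeasurableSpace Y] {m : Measure Y} {s : ℕ → Set Y}
    (h : Tendsto (fun j => m (s j)) atTop (𝓝 0)) :
    Tendsto (fun j => m.real (s j)) atTop (𝓝 0) :=
  (ENNReal.tendsto_toReal ENNReal.zero_ne_top).comp h

variable {μ : Measure X} [IsProbabilityMeasure μ] {T : X ≃ᵐ X}

/-- Uniformity in `p` matters: it will be `h - k`, with `k` found only after the tower is fixed. -/
theorem eventually_forall_bottom_independent (hT : Ergodic T μ) {ξ : ℕ → TowerPartition T}
    (hbase : Tendsto (fun j => μ.real (ξ j).base) atTop (𝓝 0)) {A : Set X} (hA : MeasurableSet A)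
    {δ : ℝ} (hδ : 0 < δ) :
    ∀ᶠ j in atTop, ∀ p,
      |μ.real (A ∩ (ξ j).bottom p) - μ.real A * μ.real ((ξ j).bottom p)| ≤ δ := by
  obtain ⟨η, hη, h⟩ := exists_forall_abs_measureReal_inter_sub_le hT hA hδ
  filter_upwards [hbase.eventually_lt_const (half_pos hη)] with j hj p
  refine h _ ((ξ j).measurableSet_bottom p) ?_
  have := (ξ j).measureReal_bottom_symmDiff_le hT.toMeasurePreserving p
  linarith

variable [StandardBorelSpace X] [Nonempty X] {ν : Measure (X × X)} [IsFiniteMeasure ν]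

theorem tendsto_measureReal_base (hT : MeasurePreserving T μ μ) (hν : IsSelfJoining μ T ν)
    (hsing : (relProd μ ν ν).MutuallySingular (diag μ)) {ξ : ℕ → TowerPartition T}
    (hξ : TendsToPoints μ ξ) {b : ℝ} (hb : 0 < b)
    (hlim : Tendsto (fun j => μ.real (ξ j).tower) atTop (𝓝 b)) :
    Tendsto (fun j => μ.real (ξ j).base) atTop (𝓝 0) := by
  have h0 : Tendsto (fun j => (relProd μ ν ν).real ((ξ j).offDiag 0)) atTop (𝓝 0) :=
    tendsto_measureReal_zero (TowerPartition.tendsto_relProd_offDiag hT hν hsing hξ 0)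
  have h1 := h0.div_const (b / 2)
  rw [zero_div] at h1
  refine squeeze_zero' (Eventually.of_forall fun _ => measureReal_nonneg) ?_ h1
  filter_upwards [hlim.eventually_const_le (half_lt_self hb)] with j hj
  rw [le_div_iff₀ (half_pos hb)]
  have := (ξ j).measureReal_tower_mul_base_le hT hν
  nlinarith [measureReal_nonneg (μ := μ) (s := (ξ j).base)]

theorem relProd_prod_compl_le_add (hν : IsSelfJoining μ T ν) {A A' : Set X}
    (hA : MeasurableSet A) (hA' : MeasurableSet A') :
    (relProd μ ν ν).real (A' ×ˢ A'ᶜ) ≤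
      (relProd μ ν ν).real (A ×ˢ Aᶜ) + 2 * μ.real (A ∆ A') := by
  have := isProbabilityMeasure_relProd (μ := μ) hν
  have hm : MeasurableSet (A ∆ A') := hA.symmDiff hA'
  have hsub : A' ×ˢ A'ᶜ ⊆
      A ×ˢ Aᶜ ∪ ((A ∆ A') ×ˢ Set.univ ∪ Set.univ ×ˢ (A ∆ A')) := by
    rintro ⟨x, y⟩ ⟨hx, hy⟩
    simp only [Set.mem_compl_iff] at hx hy
    simp only [Set.mem_union, Set.mem_prod, Set.mem_compl_iff, Set.mem_symmDiff, Set.mem_univ,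
      and_true, true_and]
    tauto
  refine (measureReal_mono hsub).trans ((measureReal_union_le _ _).trans ?_)
  refine add_le_add_right ((measureReal_union_le _ _).trans ?_) _
  rw [measureReal_def, relProd_prod_univ hν hm, measureReal_def, relProd_univ_prod hν hm, two_mul,
    measureReal_def]

/-- Pigeonhole: if each `k` had a set with too many escaping levels, then, since `h μ(B) ≤ 1`, that
set alone would pay `δ m(offDiag k)` into `∑ m(A_l × A_lᶜ)`; summing over `k` contradicts `hδ`. -/
theorem TowerPartition.exists_card_escaping_mul_le (ξ : TowerPartition T)
    (hT : MeasurePreserving T μ μ) (hν : IsSelfJoining μ T ν) (A : ℕ → Set X) (n K s : ℕ) {δ : ℝ}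
    (hδ : ∑ l ∈ Finset.range n, (relProd μ ν ν).real (A l ×ˢ (A l)ᶜ) <
      δ * ∑ k ∈ Finset.Ico K s, (relProd μ ν ν).real (ξ.offDiag k)) :
    ∃ k ∈ Finset.Ico K s, ∀ l < n, (ξ.escaping (A l) k).card * μ.real ξ.base ≤ δ := by
  by_contra! hcon
  refine hδ.not_ge ?_
  set w : ℕ → ℝ := fun k => (relProd μ ν ν).real (ξ.base ×ˢ ξ.level k)
  have hone : ξ.height * μ.real ξ.base ≤ 1 := by
    rw [← ξ.measureReal_bottom hT le_rfl]
    exact measureReal_le_one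
  have hk : ∀ k ∈ Finset.Ico K s, δ * (relProd μ ν ν).real (ξ.offDiag k) ≤
      ∑ l ∈ Finset.range n, (ξ.escaping (A l) k).card * w k := by
    intro k hk
    obtain ⟨l, hl, hlt⟩ := hcon k hk
    have hle : (ξ.escaping (A l) k).card * w k ≤
        ∑ l ∈ Finset.range n, (ξ.escaping (A l) k).card * w k :=
      Finset.single_le_sum (f := fun l => ((ξ.escaping (A l) k).card : ℝ) * w k)
        (fun i _ => by positivity) (Finset.mem_range.2 hl)
    refine le_trans ?_ hle
    have hw : 0 ≤ w k := measureReal_nonneg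
    have hsub : ((ξ.height - k : ℕ) : ℝ) * μ.real ξ.base ≤ 1 := by
      refine le_trans ?_ hone
      gcongr
      exact Nat.sub_le _ _
    rw [ξ.relProd_offDiag hT hν]
    calc δ * ((ξ.height - k : ℕ) * w k)
        ≤ ((ξ.escaping (A l) k).card * μ.real ξ.base) * ((ξ.height - k : ℕ) * w k) := by gcongr
      _ = ((ξ.escaping (A l) k).card * w k) * ((ξ.height - k : ℕ) * μ.real ξ.base) := by ring
      _ ≤ (ξ.escaping (A l) k).card * w k := mul_le_of_le_one_right (by positivity) hsub
  rw [Finset.mul_sum]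
  refine (Finset.sum_le_sum hk).trans ?_
  rw [Finset.sum_comm]
  exact Finset.sum_le_sum fun l _ => ξ.sum_card_escaping_mul_le hT hν (A l) _

theorem tendsto_sum_relProd_prod_compl {ν : ℕ → Measure (X × X)} [∀ i, IsFiniteMeasure (ν i)]
    (hν : ∀ i, IsSelfJoining μ T (ν i)) (hlim : JoiningsTendsto ν (diag μ)) {A : ℕ → Set X}
    (hA : ∀ l, MeasurableSet (A l)) (n : ℕ) :
    Tendsto (fun i => ∑ l ∈ Finset.range n,
      (relProd μ (ν i) (ν i)).real (A l ×ˢ (A l)ᶜ)) atTop (𝓝 0) := by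
  rw [← Finset.sum_const_zero (s := Finset.range n)]
  exact tendsto_finsetSum _ fun l _ => (ENNReal.tendsto_toReal ENNReal.zero_ne_top).comp
    (tendsto_relProd_prod_compl hν hlim (hA l))

theorem exists_return_time {ν : ℕ → Measure (X × X)} [∀ i, IsFiniteMeasure (ν i)]
    (hT : Ergodic T μ) (hν : ∀ i, IsSelfJoining μ T (ν i))
    (hlim : JoiningsTendsto ν (diag μ))
    (hsing : ∀ i, (relProd μ (ν i) (ν i)).MutuallySingular (diag μ)) {b : ℝ} (hb : 0 < b)
    (hrank : HasTowers μ T b) {ε : ℝ} (hε0 : 0 < ε) (hε1 : ε < 1) {A : ℕ → Set X}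
    (hA : ∀ l, MeasurableSet (A l)) (n K : ℕ) {δ : ℝ} (hδ : 0 < δ) :
    ∃ z, K ≤ z ∧ ∀ l < n, ∀ m < n,
      (1 - ε) * b * μ.real (A l ∩ A m) - δ ≤ μ.real ((T^[z]) ⁻¹' A l ∩ A m) := by
  obtain ⟨ξ, hξ, htower⟩ := hrank
  have hT' := hT.toMeasurePreserving
  choose A' hA' hlimA using fun l => hξ (A l) (hA l)
  replace hlimA : ∀ l, Tendsto (fun j => μ.real (A l ∆ A' l j)) atTop (𝓝 0) := fun l =>
    tendsto_measureReal_zero (hlimA l)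
  set N : ℕ := ⌊1 / ε⌋₊ + 1
  have hN : 1 / ε < N := by
    simpa [N] using Nat.lt_floor_add_one (1 / ε)
  have hNpos : (0 : ℝ) < N := by positivity
  set δ' := δ / 5 with hδ'
  have hδ'0 : 0 < δ' := by positivity
  -- The block bound for a tower of measure above `b / 2`; half of `c` will be lost to the
  -- off-diagonals below `K`.
  set c : ℝ := (b / 2) ^ 2 / (2 * N) with hc
  have hc0 : 0 < c := by positivity
  set σ : ℝ := δ' * c / 4 with hσ
  have hσ0 : 0 < σ := by positivity
  -- The joining is fixed before the tower: `c` does not depend on `i`, whereas off-diagonals shrink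
  -- as `j → ∞` for one given joining.
  obtain ⟨i, hi⟩ : ∃ i, ∑ l ∈ Finset.range n, (relProd μ (ν i) (ν i)).real (A l ×ˢ (A l)ᶜ)
      < σ / 2 := by
    have h := tendsto_sum_relProd_prod_compl hν hlim hA n
    exact (h.eventually_lt_const (half_pos hσ0)).exists
  have hbase := tendsto_measureReal_base hT' (hν i) (hsing i) hξ hb htower
  have hind : ∀ᶠ j in atTop, ∀ l ∈ Finset.range n, ∀ m ∈ Finset.range n, ∀ p,
      |μ.real (A l ∩ A m ∩ (ξ j).bottom p) - μ.real (A l ∩ A m) * μ.real ((ξ j).bottom p)| ≤ δ' := by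
    rw [Finset.eventually_all]
    intro l _
    rw [Finset.eventually_all]
    intro m _
    exact eventually_forall_bottom_independent hT hbase ((hA l).inter (hA m)) hδ'0
  have happrox : ∀ᶠ j in atTop, ∀ l ∈ Finset.range n, μ.real (A l ∆ A' l j) < δ' := by
    rw [Finset.eventually_all]
    exact fun l _ => (hlimA l).eventually_lt_const hδ'0
  have hsum : Tendsto (fun j => ∑ l ∈ Finset.range n, 2 * μ.real (A l ∆ A' l j)) atTop (𝓝 0) := by
    have h := tendsto_finsetSum (Finset.range n) fun l _ => (hlimA l).const_mul 2
    simpa using h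
  have hoff : Tendsto (fun j => ∑ k ∈ Finset.range K,
      (relProd μ (ν i) (ν i)).real ((ξ j).offDiag k)) atTop (𝓝 0) := by
    rw [← Finset.sum_const_zero (s := Finset.range K)]
    refine tendsto_finsetSum _ fun k _ => ?_
    exact tendsto_measureReal_zero
      (TowerPartition.tendsto_relProd_offDiag hT' (hν i) (hsing i) hξ k)
  obtain ⟨j, hj1, hj2, hj3, hj4, hj5, hj6⟩ := (hind.and (happrox.and
    ((hsum.eventually_lt_const (half_pos hσ0)).and ((hoff.eventually_lt_const (half_pos hc0)).and
    ((htower.eventually_const_lt (half_lt_self hb)).and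
      (htower.eventually_const_lt (sub_lt_self b hδ'0))))))).exists
  set η := ξ j
  -- Then `k < s` still means `k ≤ ε h`, while `N` blocks of length `s` cover the tower.
  set s : ℕ := ⌊ε * η.height⌋₊ + 1
  have hNs : η.height ≤ N * s := by
    have h1 : ε * η.height < s := by simpa [s] using Nat.lt_floor_add_one (ε * η.height)
    have h2 : (η.height : ℝ) ≤ N * s := by
      rw [div_lt_iff₀ hε0] at hN
      have hs0 : (0 : ℝ) ≤ s := by positivity
      nlinarith
    exact_mod_cast h2
  have hblock : c / 2 ≤
      ∑ k ∈ Finset.Ico K s, (relProd μ (ν i) (ν i)).real (η.offDiag k) := by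
    have h1 := η.sq_measureReal_tower_le hT' (hν i) hNs
    have h2 : c ≤ ∑ k ∈ Finset.range s, (relProd μ (ν i) (ν i)).real (η.offDiag k) := by
      rw [hc, div_le_iff₀ (by positivity)]
      have h3 : (b / 2) ^ 2 ≤ μ.real η.tower ^ 2 := by gcongr
      linarith
    have h3 : ∑ k ∈ Finset.range s, (relProd μ (ν i) (ν i)).real (η.offDiag k) ≤
        ∑ k ∈ Finset.range K ∪ Finset.Ico K s,
          (relProd μ (ν i) (ν i)).real (η.offDiag k) := by
      refine Finset.sum_le_sum_of_subset_of_nonneg (fun k hk => ?_) fun _ _ _ => measureReal_nonneg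
      simp only [Finset.mem_union, Finset.mem_range, Finset.mem_Ico] at hk ⊢
      omega
    rw [Finset.sum_union] at h3
    · linarith
    · rw [Finset.disjoint_left]
      intro k hk hk'
      simp only [Finset.mem_range, Finset.mem_Ico] at hk hk'
      omega
  obtain ⟨k, hk, hesc⟩ := η.exists_card_escaping_mul_le hT' (hν i) (fun l => A' l j) n K s
    (δ := δ') (by
      have h1 : ∑ l ∈ Finset.range n,
          (relProd μ (ν i) (ν i)).real (A' l j ×ˢ (A' l j)ᶜ) ≤
          ∑ l ∈ Finset.range n, ((relProd μ (ν i) (ν i)).real (A l ×ˢ (A l)ᶜ) +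
            2 * μ.real (A l ∆ A' l j)) :=
        Finset.sum_le_sum fun l _ =>
          relProd_prod_compl_le_add (hν i) (hA l) (hA' l j).measurableSet
      rw [Finset.sum_add_distrib] at h1
      have h2 : δ' * (c / 2) ≤ δ' * ∑ k ∈ Finset.Ico K s,
          (relProd μ (ν i) (ν i)).real (η.offDiag k) := by gcongr
      have h3 : 0 < δ' * c := by positivity
      linarith)
  obtain ⟨hKk, hks⟩ := Finset.mem_Ico.1 hk
  refine ⟨k, hKk, fun l hl m hm => ?_⟩
  set E := η.bottom (η.height - k) with hE
  have hEb : (1 - ε) * (b - δ') ≤ μ.real E := by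
    rw [η.tower_eq_bottom, η.measureReal_bottom hT' le_rfl] at hj6
    rw [hE, η.measureReal_bottom hT' (Nat.sub_le _ _)]
    have h1 : (k : ℝ) ≤ ε * η.height :=
      (Nat.cast_le.2 (Nat.lt_succ_iff.1 hks)).trans (Nat.floor_le (by positivity))
    have h2 : (η.height : ℝ) - k ≤ (η.height - k : ℕ) := by
      rw [sub_le_iff_le_add]
      exact_mod_cast (by omega : η.height ≤ η.height - k + k)
    calc (1 - ε) * (b - δ') ≤ (1 - ε) * (η.height * μ.real η.base) :=
          mul_le_mul_of_nonneg_left hj6.le (by linarith)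
      _ = (η.height - ε * η.height) * μ.real η.base := by ring
      _ ≤ (η.height - k : ℕ) * μ.real η.base := by gcongr; linarith
  -- A point of `A l ∩ A m ∩ E` either returns to `A l` under `T^k`, starts in an escaping level, or
  -- meets the approximation error at time `0` or `k`.
  have hsub : A l ∩ A m ∩ E ⊆ ((T^[k]) ⁻¹' A l ∩ A m) ∪
      ((E ∩ A' l j ∩ (T^[k]) ⁻¹' (A' l j)ᶜ) ∪
        ((A l ∆ A' l j) ∪ (T^[k]) ⁻¹' (A l ∆ A' l j))) := by
    rintro x ⟨⟨h1, h2⟩, h3⟩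
    simp only [Set.mem_union, Set.mem_inter_iff, Set.mem_preimage, Set.mem_compl_iff,
      Set.mem_symmDiff]
    tauto
  have h1 : μ.real (A l ∩ A m ∩ E) ≤ μ.real ((T^[k]) ⁻¹' A l ∩ A m) + (δ' + (δ' + δ')) := by
    refine (measureReal_mono hsub).trans ((measureReal_union_le _ _).trans ?_)
    refine add_le_add_right ((measureReal_union_le _ _).trans (add_le_add ?_
      ((measureReal_union_le _ _).trans (add_le_add ?_ ?_)))) _
    · exact (TowerPartition.measureReal_bottom_inter_escaping_le hT' (hA' l j) k).trans (hesc l hl)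
    · exact (hj2 l (Finset.mem_range.2 hl)).le
    · rw [(hT'.iterate k).measureReal_preimage
        ((hA l).symmDiff (hA' l j).measurableSet).nullMeasurableSet]
      exact (hj2 l (Finset.mem_range.2 hl)).le
  have h2 := (abs_le.1 (hj1 l (Finset.mem_range.2 hl) m (Finset.mem_range.2 hm)
    (η.height - k))).1
  rw [← hE] at h2
  have h3 : μ.real (A l ∩ A m) * ((1 - ε) * (b - δ')) ≤ μ.real (A l ∩ A m) * μ.real E := by gcongr
  have h4 : μ.real (A l ∩ A m) * ((1 - ε) * δ') ≤ δ' := by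
    have h5 : μ.real (A l ∩ A m) * (1 - ε) ≤ 1 :=
      mul_le_one₀ measureReal_le_one (by linarith) (by linarith)
    nlinarith
  have h6 : δ = 5 * δ' := by rw [hδ']; ring
  nlinarith

end ReturnTimes

/-! ### From return times to the limit operator and partial rigidity. -/

section Main

/-- The supremum need not be attained for the argument. Its positivity excludes the default value
`0` of `sSup ∅`. -/
theorem exists_hasTowers_gt {μ : Measure X} {T : X ≃ᵐ X} {a : ℝ} (h0 : 0 < localRank μ T) (ha : a < localRank μ T) :
    ∃ b, HasTowers μ T b ∧ a < b := by
  refine exists_lt_of_lt_csSup (s := {b | HasTowers μ T b}) (Set.nonempty_iff_ne_empty.2 fun hne => ?_) ha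
  rw [localRank, hne, Real.sSup_empty] at h0
  exact lt_irrefl _ h0

variable {μ : Measure X} [IsProbabilityMeasure μ] {T : X ≃ᵐ X}

theorem exists_seq_measureReal_dense [StandardBorelSpace X] (μ : Measure X)
    [IsProbabilityMeasure μ] :
    ∃ A : ℕ → Set X, (∀ n, MeasurableSet (A n)) ∧
      ∀ S, MeasurableSet S → ∀ δ : ℝ, 0 < δ → ∃ n, μ.real (S ∆ A n) < δ := by
  obtain ⟨𝒜, hc, h⟩ := exists_countable_measureDense (μ := μ)
  obtain ⟨A, rfl⟩ := hc.exists_eq_range h.nonempty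
  refine ⟨A, fun n => h.measurable _ ⟨n, rfl⟩, fun S hS δ hδ => ?_⟩
  obtain ⟨-, ⟨n, rfl⟩, hn⟩ := h.approx S hS (measure_ne_top _ _) δ hδ
  exact ⟨n, (ENNReal.lt_ofReal_iff_toReal_lt (measure_ne_top _ _)).1 hn⟩

theorem exists_seq_forall_eventually_le [StandardBorelSpace X] (hT : MeasurePreserving T μ μ)
    {c : ℝ} (hc0 : 0 ≤ c) (hc1 : c ≤ 1)
    (h : ∀ A : ℕ → Set X, (∀ l, MeasurableSet (A l)) → ∀ n K : ℕ, ∀ δ : ℝ, 0 < δ →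
      ∃ z, K ≤ z ∧ ∀ l < n, ∀ m < n,
        c * μ.real (A l ∩ A m) - δ ≤ μ.real ((T^[z]) ⁻¹' A l ∩ A m)) :
    ∃ z : ℕ → ℕ, Tendsto z atTop atTop ∧ ∀ A B : Set X, MeasurableSet A → MeasurableSet B →
      ∀ δ : ℝ, 0 < δ →
        ∀ᶠ i in atTop, c * μ.real (A ∩ B) - δ ≤ μ.real ((T^[z i]) ⁻¹' A ∩ B) := by
  obtain ⟨A, hA, hdense⟩ := exists_seq_measureReal_dense μ
  -- Diagonal choice: the `i`-th time serves the first `i` sets of the dense family with error `1 /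
  -- (i + 1)` and is at least `i`.
  choose z hz hz' using fun i : ℕ => h A hA i i (1 / ((i : ℝ) + 1)) (by positivity)
  refine ⟨z, tendsto_atTop_mono hz tendsto_id, fun S R hS hR δ hδ => ?_⟩
  obtain ⟨l, hl⟩ := hdense S hS (δ / 5) (by positivity)
  obtain ⟨m, hm⟩ := hdense R hR (δ / 5) (by positivity)
  filter_upwards [eventually_gt_atTop l, eventually_gt_atTop m,
    tendsto_one_div_add_atTop_nhds_zero_nat.eventually_lt_const
      (show (0 : ℝ) < δ / 5 by positivity)] with i hil him hi
  have h1 := hz' i l hil m him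
  have h2 : μ.real (S ∩ R) ≤ μ.real (A l ∩ A m) + (μ.real (S ∆ A l) + μ.real (R ∆ A m)) := by
    refine (measureReal_mono (?_ : _ ⊆ (A l ∩ A m) ∪ ((S ∆ A l) ∪ (R ∆ A m)))).trans
      ((measureReal_union_le _ _).trans (add_le_add_right (measureReal_union_le _ _) _))
    rintro x ⟨h1, h2⟩
    simp only [Set.mem_union, Set.mem_inter_iff, Set.mem_symmDiff]
    tauto
  have h3 : μ.real ((T^[z i]) ⁻¹' A l ∩ A m) ≤ μ.real ((T^[z i]) ⁻¹' S ∩ R) +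
      (μ.real (S ∆ A l) + μ.real (R ∆ A m)) := by
    rw [← (hT.iterate (z i)).measureReal_preimage (hS.symmDiff (hA l)).nullMeasurableSet]
    refine (measureReal_mono (?_ : _ ⊆ ((T^[z i]) ⁻¹' S ∩ R) ∪
      ((T^[z i]) ⁻¹' (S ∆ A l) ∪ (R ∆ A m)))).trans
      ((measureReal_union_le _ _).trans (add_le_add_right (measureReal_union_le _ _) _))
    rintro x ⟨h1, h2⟩
    simp only [Set.mem_union, Set.mem_inter_iff, Set.mem_symmDiff, Set.mem_preimage] at h1 ⊢
    tauto
  have h4 : c * μ.real (S ∩ R) ≤ c * (μ.real (A l ∩ A m) + (δ / 5 + δ / 5)) := by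
    gcongr
    linarith
  have h5 : c * (δ / 5 + δ / 5) ≤ δ / 5 + δ / 5 := mul_le_of_le_one_left (by positivity) hc1
  linarith

theorem exists_weakOpTendsto [StandardBorelSpace X] (hT : MeasurePreserving T μ μ) {c : ℝ}
    {z : ℕ → ℕ} (hz : Tendsto z atTop atTop)
    (h : ∀ A B : Set X, MeasurableSet A → MeasurableSet B → ∀ δ : ℝ, 0 < δ →
      ∀ᶠ i in atTop, c * μ.real (A ∩ B) - δ ≤ μ.real ((T^[z i]) ⁻¹' A ∩ B)) :
    ∃ z : ℕ → ℕ, Tendsto z atTop atTop ∧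
      ∃ Q : Lp ℝ 2 μ →L[ℝ] Lp ℝ 2 μ, IsPositiveOp Q ∧
        WeakOpTendsto (fun i => koopman hT ^ z i)
          (c • ContinuousLinearMap.id ℝ (Lp ℝ 2 μ) + Q) := by
  have : Fact ((2 : ENNReal) ≠ ⊤) := ⟨by norm_num⟩
  have hnorm : ∀ i, ‖koopman hT ^ i‖ ≤ 1 := fun i => by
    induction i with
    | zero => exact ContinuousLinearMap.norm_id_le
    | succ i ih =>
      rw [pow_succ]
      exact (norm_mul_le _ _).trans (mul_le_one₀ ih (norm_nonneg _) (norm_koopman_le hT))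
  obtain ⟨φ, hφ, P, hP⟩ := exists_subseq_tendsto_inner (fun i => koopman hT ^ z i)
    fun i => hnorm (z i)
  -- `Q` is the weak limit minus `c • id`; the lower bounds on rectangles say that it is nonnegative
  -- on pairs of indicators.
  refine ⟨z ∘ φ, hz.comp hφ.tendsto_atTop, P - c • ContinuousLinearMap.id ℝ _, ?_, ?_⟩
  · refine isPositiveOp_of_inner_indicator_nonneg _ fun A B hA hB => ?_
    have h1 := hP (indicatorConstLp 2 hA (measure_ne_top μ A) 1)
      (indicatorConstLp 2 hB (measure_ne_top μ B) 1)
    simp only [inner_koopman_pow_indicator hT _ hA hB] at h1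
    rw [sub_apply, smul_apply, ContinuousLinearMap.id_apply, inner_sub_left,
      real_inner_smul_left, inner_indicator_indicator hA hB, sub_nonneg]
    refine le_of_forall_pos_sub_le fun δ hδ => ?_
    exact ge_of_tendsto h1 (hφ.tendsto_atTop.eventually (h A B hA hB δ hδ))
  · intro f g
    rw [add_sub_cancel]
    exact hP f g

theorem HasTowers.le_one {b : ℝ} (h : HasTowers μ T b) : b ≤ 1 := by
  obtain ⟨ξ, -, h⟩ := h
  exact le_of_tendsto' h fun _ => measureReal_le_one

theorem localRank_le_one (h : 0 < localRank μ T) : localRank μ T ≤ 1 := by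
  refine csSup_le (Set.nonempty_iff_ne_empty.2 fun hne => ?_) fun b hb => hb.le_one
  rw [localRank, hne, Real.sSup_empty] at h
  exact lt_irrefl _ h

theorem partiallyRigid_of_weakOpTendsto (hT : MeasurePreserving T μ μ) {ρ : ℝ} (h0 : 0 < ρ)
    (h1 : ρ ≤ 1) {z : ℕ → ℕ} (hz : Tendsto z atTop atTop) {Q : Lp ℝ 2 μ →L[ℝ] Lp ℝ 2 μ}
    (hQ : IsPositiveOp Q)
    (hlim : WeakOpTendsto (fun i => koopman hT ^ z i)
      (ρ • ContinuousLinearMap.id ℝ (Lp ℝ 2 μ) + Q)) : PartiallyRigid μ T := by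
  refine ⟨ρ, h0, h1, fun A hA => ?_⟩
  set f : Lp ℝ 2 μ := indicatorConstLp 2 hA (measure_ne_top μ A) 1
  have hf : 0 ≤ f := by
    rw [← Lp.coeFn_nonneg]
    filter_upwards [indicatorConstLp_coeFn (p := 2) (hs := hA) (hμs := measure_ne_top μ A)
      (c := (1 : ℝ))] with x hx
    rw [hx]
    exact Set.indicator_nonneg (fun _ _ => zero_le_one) x
  have hQf : 0 ≤ inner ℝ (Q f) f := by
    rw [L2.inner_def]
    refine integral_nonneg_of_ae ?_
    filter_upwards [(Lp.coeFn_nonneg _).2 (hQ f hf), (Lp.coeFn_nonneg _).2 hf] with x h1 h2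
    simpa using mul_nonneg h2 h1
  have h := hlim f f
  simp only [f, inner_koopman_pow_indicator hT _ hA hA] at h
  have himage : ∀ n, μ.real ((T^[n]) ⁻¹' A ∩ A) = μ.real (A ∩ (T^[n]) '' A) := fun n => by
    rw [← (hT.iterate n).measureReal_preimage
      (hA.inter (measurableSet_image_iterate T n hA)).nullMeasurableSet, Set.preimage_inter,
      Set.preimage_image_eq _ (T.injective.iterate n)]
  simp only [himage] at h
  have h' := (ENNReal.continuous_ofReal.tendsto _).comp h
  have hreal : (ENNReal.ofReal ∘ fun i => μ.real (A ∩ (T^[z i]) '' A)) =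
      fun i => μ (A ∩ (T^[z i]) '' A) := funext fun _ => ofReal_measureReal
  rw [hreal] at h'
  calc ENNReal.ofReal ρ * μ A = ENNReal.ofReal (ρ * μ.real A) := by
        rw [ENNReal.ofReal_mul h0.le, ofReal_measureReal]
    _ ≤ _ := by
        refine ENNReal.ofReal_le_ofReal (q := inner ℝ
          ((ρ • ContinuousLinearMap.id ℝ (Lp ℝ 2 μ) + Q) f) f) ?_
        rw [add_apply, smul_apply, ContinuousLinearMap.id_apply, inner_add_left,
          real_inner_smul_left, inner_indicator_indicator hA hA, Set.inter_self]
        linarith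
    _ = limsup (fun i => μ (A ∩ (T^[z i]) '' A)) atTop := h'.limsup_eq.symm
    _ ≤ limsup (fun n => μ (A ∩ (T^[n]) '' A)) atTop :=
        hz.limsup_comp_le_limsup (u := fun n => μ (A ∩ (T^[n]) '' A))

end Main

end LocalRank

end
theorem theorem4 {X : Type*} [MeasurableSpace X] [StandardBorelSpace X] [Nonempty X]
    (μ : Measure X) [IsProbabilityMeasure μ] (T : X ≃ᵐ X) (hT : Ergodic T μ)
    (hrank : 0 < LocalRank.localRank μ T)
    (ν : ℕ → Measure (X × X)) [∀ i, IsFiniteMeasure (ν i)]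
    (hν : ∀ i, LocalRank.IsSelfJoining μ T (ν i))
    (hlim : LocalRank.JoiningsTendsto ν (LocalRank.diag μ))
    (hsing : ∀ i, (LocalRank.relProd μ (ν i) (ν i)).MutuallySingular (LocalRank.diag μ)) :
    LocalRank.PartiallyRigid μ T ∧
      ∀ ε : ℝ, 0 < ε → ε < 1 →
        ∃ z : ℕ → ℕ, Tendsto z atTop atTop ∧
          ∃ Q : Lp ℝ 2 μ →L[ℝ] Lp ℝ 2 μ, LocalRank.IsPositiveOp Q ∧
            LocalRank.WeakOpTendsto
              (fun i => LocalRank.koopman hT.toMeasurePreserving ^ z i)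
              ((LocalRank.localRank μ T * (1 - ε)) •
                ContinuousLinearMap.id ℝ (Lp ℝ 2 μ) + Q) := by
  have hle := LocalRank.localRank_le_one hrank
  have key : ∀ ε : ℝ, 0 < ε → ε < 1 →
      ∃ z : ℕ → ℕ, Tendsto z atTop atTop ∧
        ∃ Q : Lp ℝ 2 μ →L[ℝ] Lp ℝ 2 μ, LocalRank.IsPositiveOp Q ∧
          LocalRank.WeakOpTendsto
            (fun i => LocalRank.koopman hT.toMeasurePreserving ^ z i)
            ((LocalRank.localRank μ T * (1 - ε)) •
              ContinuousLinearMap.id ℝ (Lp ℝ 2 μ) + Q) := by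
    intro ε hε0 hε1
    set c := LocalRank.localRank μ T * (1 - ε) with hc
    have hc0 : 0 < c := mul_pos hrank (by linarith)
    have hclt : c < LocalRank.localRank μ T := by rw [hc]; nlinarith
    obtain ⟨b, hb, hcb⟩ := LocalRank.exists_hasTowers_gt hrank hclt
    have hb0 : 0 < b := hc0.trans hcb
    -- Towers of measure `b > c` are used with loss `1 - c / b` instead of `ε`, so that the constant
    -- is exactly `c` although `b` may fall short of the local rank.
    have hcb' : (1 - (1 - c / b)) * b = c := by field_simp; ring
    obtain ⟨z, hz, hz'⟩ := LocalRank.exists_seq_forall_eventually_le hT.toMeasurePreserving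
      hc0.le (hclt.le.trans hle) fun A hA n K δ hδ => by
        have h := LocalRank.exists_return_time hT hν hlim hsing hb0 hb
          (ε := 1 - c / b) (by rw [sub_pos, div_lt_one hb0]; exact hcb)
          (by linarith [div_pos hc0 hb0]) hA n K hδ
        rwa [hcb'] at h
    exact LocalRank.exists_weakOpTendsto hT.toMeasurePreserving hz hz'
  refine ⟨?_, key⟩
  obtain ⟨z, hz, Q, hQ, h⟩ := key (1 / 2) (by norm_num) (by norm_num)
  exact LocalRank.partiallyRigid_of_weakOpTendsto hT.toMeasurePreserving
    (by linarith) (by linarith) hz hQ h
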